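/- **Theorem 1.2.** Let $(R,\mathfrak m)$ be a (Noetherian) local Gorenstein ring and let $J\subseteq I$ be two ideals of $R$, both of height $c$. For an ideal $K$ of $R$ let $H^i_K(R)$ denote the $i$-th local cohomology module of $R$ with support in $K$. (a) There is a natural homomorphism of $R$-algebras $$\varphi:\operatorname{Hom}_R(H^c_J(R),H^c_J(R))\to\operatorname{Hom}_R(H^c_I(R),H^c_I(R)).$$ It is the unique $R$-algebra homomorphism with $\iota\circ\varphi(f)=f\circ\iota$ for all $f$, where $\iota:H^c_I(R)\to H^c_J(R)$ is the natural map induced by the projections $R/J^\alpha\to R/I^\alpha$. Moreover, under natural isomorphisms $\operatorname{Hom}_R(H^c_K(R),H^c_K(R))\cong\operatorname{Ext}^c_R(H^c_K(R),R)$ for $K=J$ and $K=I$, it is the map $\operatorname{Ext}^c_R(\iota,R)$. Here natural means: $f$ corresponds to $\operatorname{Ext}^c_R(f,R)(\varepsilon_K)$, where $\varepsilon_K$ corresponds to the identity of $H^c_K(R)$. (b) Suppose that $\operatorname{Rad}(JR_{\mathfrak p})=\operatorname{Rad}(IR_{\mathfrak p})$ for all prime ideals $\mathfrak p\in V(J)$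 with $\dim R_{\mathfrak p}\le c+1$. Then $\varphi$ is an isomorphism. (c) Suppose that $R$ is in addition complete, that $J$ is a cohomologically complete intersection, i.e. $c=\operatorname{height} J$ equals $\sup\{i : H^i_J(R)\ne 0\}$, and that $\operatorname{Rad}(JR_{\mathfrak p})=\operatorname{Rad}(IR_{\mathfrak p})$ for all prime ideals $\mathfrak p\in V(I)$ with $\dim R_{\mathfrak p}\le c+1$. Then the natural homomorphism $R\to\operatorname{Hom}_R(H^c_I(R),H^c_I(R))$ is an isomorphism. -/

import Mathlib

open CategoryTheory CategoryTheory.Limits Opposite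

universe u

noncomputable section

/-- A local Gorenstein ring: a Noetherian local ring of finite injective dimension over itself. -/
class IsLocalGorenstein (R : Type u) [CommRing R] : Prop extends
    IsLocalRing R, IsNoetherianRing R where
  finite_injectiveDimension : injectiveDimension (ModuleCat.of R R) < ⊤

namespace LocalCohomologyEnd

variable {R : Type u} [CommRing R]

/-- The local cohomology module `H^i_I(R)`, the direct limit of the modules `Ext^i(R/I^t, R)`. -/
abbrev H (I : Ideal R) (i : ℕ) : ModuleCat.{u} R :=
  (localCohomology I i).obj (ModuleCat.of R R)

/-- The projections `R/J^t → R/I^t`, for `J ≤ I`, as a map of inverse systems. -/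
def quotientPowMap {J I : Ideal R} (h : J ≤ I) :
    localCohomology.ringModIdeals (localCohomology.idealPowersDiagram J) ⟶
      localCohomology.ringModIdeals (localCohomology.idealPowersDiagram I) where
  app t := ModuleCat.ofHom
    (Submodule.mapQ (J ^ unop t) (I ^ unop t) LinearMap.id (Ideal.pow_right_mono h (unop t)))
  naturality s t f := by
    apply ModuleCat.hom_ext
    apply LinearMap.ext
    intro x
    obtain ⟨y, rfl⟩ := Submodule.mkQ_surjective _ x
    rfl

/-- The natural transformation `H^i_I → H^i_J`, for `J ≤ I`: the direct limit of the maps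
`Ext^i(R/I^t, -) → Ext^i(R/J^t, -)` induced by the projections `R/J^t → R/I^t`. -/
def localCohomologyMap {J I : Ideal R} (h : J ≤ I) (i : ℕ) :
    localCohomology I i ⟶ localCohomology J i :=
  colimMap (Functor.whiskerRight (NatTrans.op (quotientPowMap h)) (Ext R (ModuleCat.{u} R) i))

/-- The natural `R`-linear map `H^i_I(R) → H^i_J(R)`, for `J ≤ I`. -/
def incl {J I : Ideal R} (h : J ≤ I) (i : ℕ) : H I i →ₗ[R] H J i :=
  ((localCohomologyMap h i).app (ModuleCat.of R R)).hom

/-- The module `Ext^i_R(M, R)`. -/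
abbrev ExtR (M : ModuleCat.{u} R) (i : ℕ) : ModuleCat.{u} R :=
  ((Ext R (ModuleCat.{u} R) i).obj (op M)).obj (ModuleCat.of R R)

/-- The map `Ext^i_R(f, R) : Ext^i_R(N, R) → Ext^i_R(M, R)` induced by `f : M → N`. -/
def extMap {M N : ModuleCat.{u} R} (f : M →ₗ[R] N) (i : ℕ) : ExtR N i →ₗ[R] ExtR M i :=
  (((Ext R (ModuleCat.{u} R) i).map (ModuleCat.ofHom f).op).app (ModuleCat.of R R)).hom

/-- The homomorphism `φ : End(H^c_J(R)) → End(H^c_I(R))` is restriction of endomorphisms along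
the natural map `H^c_I(R) → H^c_J(R)`. -/
def IsRestriction {J I : Ideal R} (h : J ≤ I) (c : ℕ)
    (φ : Module.End R (H J c) →ₐ[R] Module.End R (H I c)) : Prop :=
  ∀ f : Module.End R (H J c), incl h c ∘ₗ φ f = f ∘ₗ incl h c

/-- The homomorphism `φ : End(H^c_J(R)) → End(H^c_I(R))` is the map
`Ext^c(H^c_J(R), R) → Ext^c(H^c_I(R), R)` induced by `H^c_I(R) → H^c_J(R)`, under identifications
`End(H^c_J(R)) ≃ Ext^c(H^c_J(R), R)` and `End(H^c_I(R)) ≃ Ext^c(H^c_I(R), R)` that are natural: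
they send an endomorphism `f` to the image, under `Ext^c(f, R)`, of the class of the identity, and
the class of the identity of `H^c_J(R)` restricts to that of `H^c_I(R)`. -/
def IsInducedByExt {J I : Ideal R} (h : J ≤ I) (c : ℕ)
    (φ : Module.End R (H J c) →ₐ[R] Module.End R (H I c)) : Prop :=
  ∃ (θJ : Module.End R (H J c) ≃ₗ[R] ExtR (H J c) c)
    (θI : Module.End R (H I c) ≃ₗ[R] ExtR (H I c) c),
    (∀ f, θJ f = extMap f c (θJ LinearMap.id)) ∧
    (∀ g, θI g = extMap g c (θI LinearMap.id)) ∧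
    ∀ f, θI (φ f) = extMap (incl h c) c (θJ f)

/-- The cohomological dimension of `I`: the supremum of all `i` with `H^i_I(R) ≠ 0`. -/
def cohomologicalDimension (I : Ideal R) : ℕ∞ :=
  ⨆ (i : ℕ) (_ : Nontrivial (H I i)), (i : ℕ∞)

/-- `I` is a cohomologically complete intersection: its height is its cohomological dimension. -/
def IsCohomologicallyCompleteIntersection (I : Ideal R) : Prop :=
  I.height = cohomologicalDimension I

/-- `J R_𝔭` and `I R_𝔭` have the same radical. -/
def SameRadicalAt (J I : Ideal R) (p : PrimeSpectrum R) : Prop :=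
  (J.map (algebraMap R (Localization.AtPrime p.asIdeal))).radical =
    (I.map (algebraMap R (Localization.AtPrime p.asIdeal))).radical

end LocalCohomologyEnd

end

/-!
Over a local Gorenstein ring `R`, the module `H^c_J(R)` of an ideal `J` of height `c` sits inside a
module `N` that represents `Ext^c(-, R)` on modules of `J`-power torsion, and everything is read off
from `N`.

*The module `N`.* Over a Noetherian ring the `J`-power torsion of an injective module is injective
(`injective_powerTorsion`), so a `J`-torsion-free module embeds into a `J`-torsion-free injective
module, to which modules of `J`-power torsion are orthogonal. As `Ext^k(R/J, R) = 0` for `k < c`,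
such an embedding can be taken `c` times, starting with `R`. The last cosyzygy `N` carries a class
`η ∈ Ext^c(N, R)`, and Yoneda product with `η` is an isomorphism `Ext^i(M, N) ≃ Ext^{i+c}(M, R)` for
all `M` of `J`-power torsion (`exists_isTorsionDualizing`). In particular `H^c_J(R)` is the
`J`-power torsion of `N`. The same `N` serves every `I ⊇ J`, so `H^c_I(R)` is the `I`-power torsion
of `N`. Hence `H^c_I(R) → H^c_J(R)` is injective with image stable under endomorphisms, which gives
the restriction map `φ`, and `End(H^c_K(R)) = Hom(H^c_K(R), N) = Ext^c(H^c_K(R), R)` naturally.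

*Vanishing.* `Ext^i(M, R) = 0` for `M` finitely generated and supported in codimension greater than
`i` (`subsingleton_ext_of_forall_height`). This is where `R` being Gorenstein is used: Bass's lemma
(`ExtLocNonzero.succ`) makes `Ext^{ht p}(R/p, R)` nonzero, so the last degree in which `Ext(-, R)`
is nonzero is at least the height of the maximal ideal, and finiteness of the injective dimension
then forces the depth of `R` to be at least that height. It follows that `Hom(C, N)` and `Ext^1(C,
N)` vanish for all `C` of `J`-power torsion supported in codimension at least `c + 2`, and that maps
to `N` extend uniquely along maps with such a cokernel (`comp_bijective_of_codim`). If `J` and `I`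
have the same radical at all primes of height at most `c + 1`, this applies to `H^c_I(R) →
H^c_J(R)`, so `φ` is bijective.

*Complete rings.* If `x` acts bijectively on `A` and `R` is complete with respect to an ideal
containing `x`, then `Ext(A, R) = 0`: the telescope map `(a_t) ↦ (a_t - x a_{t+1})` is invertible on
`R^ℕ`, but kills the element of `Ext(A, R^ℕ) = Ext(A, R)^ℕ` with components `x^{-t} e`. By
dévissage, `J`-torsion-free injective modules are orthogonal to `R`, and so are all modules without
local cohomology, since the injective dimension of `R` is finite. When `J` is a cohomologically
complete intersection, `N / H^c_J(R)` is such a module, whence `R = Ext^0(R, R) = Ext^c(N, R) =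
Ext^c(H^c_J(R), R) = End(H^c_J(R))` (`algebraMap_end_bijective`). If `J` and `I` agree up to radical
only at the primes of `V(I)` of height at most `c + 1`, then, up to modules supported in codimension
at least `c + 2`, the module `H^c_J(R)` is the direct sum of `H^c_I(R)` and its power torsion for
the saturation `(J : I^∞)`. The projection to the second summand extends to a homothety of
`H^c_J(R)`; since `R` is local and `H^c_I(R) ≠ 0`, the second summand is zero, and `φ` is bijective.
-/

open scoped Pointwise

noncomputable section

namespace LocalCohomologyEnd

/-! ### Two constructions of `Ext` -/

section Comparison

variable {R : Type u} [CommRing R] {X X' Y : ModuleCat.{u} R}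

/-- The module of degree `n` cocycles of `Hom(P, Y)`, for a projective resolution `P`. -/
def cocycles (P : ProjectiveResolution X) (Y : ModuleCat.{u} R) (n : ℕ) :
    Submodule R (P.complex.X n ⟶ Y) :=
  LinearMap.ker (Linear.leftComp R Y (P.complex.d (n + 1) n))

lemma mem_cocycles {P : ProjectiveResolution X} {n : ℕ} {f : P.complex.X n ⟶ Y} :
    f ∈ cocycles P Y n ↔ P.complex.d (n + 1) n ≫ f = 0 := Iff.rfl

/-- The functor `Hom(-, Y)` whose left derived functors are `Ext`. -/
abbrev homTo (Y : ModuleCat.{u} R) : ModuleCat.{u} R ⥤ (ModuleCat.{u} R)ᵒᵖ :=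
  ((linearYoneda R (ModuleCat.{u} R)).obj Y).rightOp

/-- The complex `Hom(P, Y)` in the opposite category. -/
abbrev homComplex (P : ProjectiveResolution X) (Y : ModuleCat.{u} R) :
    ChainComplex (ModuleCat.{u} R)ᵒᵖ ℕ :=
  ((homTo Y).mapHomologicalComplex _).obj P.complex

/-- The inclusion of the cocycles into `Hom(P_n, Y)`, in the opposite category. -/
def cocyclesIncl (P : ProjectiveResolution X) (Y : ModuleCat.{u} R) (n : ℕ) :
    (homComplex P Y).X n ⟶ op (ModuleCat.of R (cocycles P Y n)) :=
  Quiver.Hom.op (ModuleCat.ofHom (cocycles P Y n).subtype)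

lemma d_comp_cocyclesIncl (P : ProjectiveResolution X) (Y : ModuleCat.{u} R) (n : ℕ) :
    (homComplex P Y).d (n + 1) n ≫ cocyclesIncl P Y n = 0 := by
  apply Quiver.Hom.unop_inj
  ext f
  exact f.2

/-- In the opposite category, the cycles of `Hom(P, Y)` are the opcycles of `homComplex P Y`; they
are compared with the submodule of cocycles. -/
def opcyclesToCocycles (P : ProjectiveResolution X) (Y : ModuleCat.{u} R) (n : ℕ) :
    (homComplex P Y).opcycles n ⟶ op (ModuleCat.of R (cocycles P Y n)) :=
  (homComplex P Y).descOpcycles (cocyclesIncl P Y n) (n + 1) (by simp) (d_comp_cocyclesIncl P Y n)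

/-- `Ext^n(X, Y)`, in the opposite category, is the homology of `Hom(P, Y)`. -/
def leftDerivedIso (P : ProjectiveResolution X) (Y : ModuleCat.{u} R) (n : ℕ) :
    ((homTo Y).leftDerived n).obj X ≅ (homComplex P Y).homology n :=
  P.isoLeftDerivedObj (homTo Y) n

/-- The class in `Ext^n(X, Y)` of a cocycle of `Hom(P, Y)`. -/
def classMap (P : ProjectiveResolution X) (Y : ModuleCat.{u} R) (n : ℕ) :
    cocycles P Y n →ₗ[R] ((Ext R (ModuleCat.{u} R) n).obj (op X)).obj Y :=
  (((leftDerivedIso P Y n).hom ≫ (homComplex P Y).homologyι n ≫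
    opcyclesToCocycles P Y n).unop).hom

lemma pOpcycles_opcyclesToCocycles (P : ProjectiveResolution X) (Y : ModuleCat.{u} R) (n : ℕ) :
    (homComplex P Y).pOpcycles n ≫ opcyclesToCocycles P Y n = cocyclesIncl P Y n :=
  (homComplex P Y).p_descOpcycles _ _ _ _

lemma unop_opcyclesToCocycles_surjective (P : ProjectiveResolution X) (Y : ModuleCat.{u} R)
    (n : ℕ) (w : ((homComplex P Y).opcycles n).unop) :
    ∃ z : cocycles P Y n, (opcyclesToCocycles P Y n).unop.hom z = w := by
  have hp : Function.Injective ((homComplex P Y).pOpcycles n).unop.hom :=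
    (ModuleCat.mono_iff_injective _).1 inferInstance
  have h0 : ((homComplex P Y).pOpcycles n).unop ≫ ((homComplex P Y).d (n + 1) n).unop = 0 := by
    rw [← unop_comp, (homComplex P Y).d_pOpcycles, unop_zero]
  refine ⟨⟨((homComplex P Y).pOpcycles n).unop.hom w, ?_⟩, hp ?_⟩
  · exact congr($h0 w)
  · have h z := congr(ModuleCat.Hom.hom (Quiver.Hom.unop $(pOpcycles_opcyclesToCocycles P Y n)) z)
    exact h ⟨_, _⟩

lemma classMap_naturality {P : ProjectiveResolution X} {Q : ProjectiveResolution X'}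
    {f : X ⟶ X'} (φ : ProjectiveResolution.Hom P Q f) (n : ℕ) (z : cocycles Q Y n)
    (hz : φ.hom.f n ≫ z.1 ∈ cocycles P Y n) :
    (((Ext R (ModuleCat.{u} R) n).map f.op).app Y).hom (classMap Q Y n z) =
      classMap P Y n ⟨φ.hom.f n ≫ z.1, hz⟩ := by
  let θ : cocycles Q Y n →ₗ[R] cocycles P Y n :=
    (Linear.leftComp R Y (φ.hom.f n)).restrict fun z hz ↦ by
      rw [mem_cocycles] at hz ⊢
      simp [← φ.hom.comm_assoc, hz]
  have h1 : ((homTo Y).leftDerived n).map f ≫ (leftDerivedIso Q Y n).hom =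
      (leftDerivedIso P Y n).hom ≫
        HomologicalComplex.homologyMap (((homTo Y).mapHomologicalComplex _).map φ.hom) n :=
    ProjectiveResolution.isoLeftDerivedObj_hom_naturality f P Q φ.hom
      (by simpa using φ.hom_f_zero_comp_π_f_zero) (homTo Y) n
  have h2 : HomologicalComplex.opcyclesMap (((homTo Y).mapHomologicalComplex _).map φ.hom) n ≫
      opcyclesToCocycles Q Y n = opcyclesToCocycles P Y n ≫ Quiver.Hom.op (ModuleCat.ofHom θ) := by
    rw [← cancel_epi ((homComplex P Y).pOpcycles n), HomologicalComplex.p_opcyclesMap_assoc,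
      pOpcycles_opcyclesToCocycles, ← Category.assoc, pOpcycles_opcyclesToCocycles]
    rfl
  have h3 : ((homTo Y).leftDerived n).map f ≫ (leftDerivedIso Q Y n).hom ≫
      (homComplex Q Y).homologyι n ≫ opcyclesToCocycles Q Y n =
      ((leftDerivedIso P Y n).hom ≫ (homComplex P Y).homologyι n ≫
        opcyclesToCocycles P Y n) ≫ Quiver.Hom.op (ModuleCat.ofHom θ) := by
    rw [reassoc_of% h1, HomologicalComplex.homologyι_naturality_assoc, h2]
    simp only [Category.assoc]
  exact congr(ModuleCat.Hom.hom (Quiver.Hom.unop $h3) z)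

lemma classMap_surjective (P : ProjectiveResolution X) (Y : ModuleCat.{u} R) (n : ℕ) :
    Function.Surjective (classMap P Y n) := by
  intro e
  have h1 : Function.Surjective
      ((leftDerivedIso P Y n).hom ≫ (homComplex P Y).homologyι n).unop.hom :=
    (ModuleCat.epi_iff_surjective _).1 (unop_epi_of_mono _)
  obtain ⟨w, rfl⟩ := h1 e
  obtain ⟨z, rfl⟩ := unop_opcyclesToCocycles_surjective P Y n w
  exact ⟨z, rfl⟩

lemma classMap_eq_zero_iff_exists (P : ProjectiveResolution X) (n : ℕ) (z : cocycles P Y n)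
    (j : ℕ) (hj : (ComplexShape.down ℕ).next n = j) :
    classMap P Y n z = 0 ↔ ∃ g : P.complex.X j ⟶ Y, P.complex.d n j ≫ g = z.1 := by
  have hp : Function.Injective ((homComplex P Y).pOpcycles n).unop.hom :=
    (ModuleCat.mono_iff_injective _).1 inferInstance
  have h1 : Function.Injective (leftDerivedIso P Y n).hom.unop.hom :=
    (ModuleCat.mono_iff_injective _).1 inferInstance
  have h2 g := congr(ModuleCat.Hom.hom (Quiver.Hom.unop $((homComplex P Y).p_fromOpcycles n j)) g)
  have h3 := congr(ModuleCat.Hom.hom (Quiver.Hom.unop $(pOpcycles_opcyclesToCocycles P Y n)) z)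
  have hS : (ShortComplex.mk _ _ ((homComplex P Y).homologyι_comp_fromOpcycles n j)).Exact :=
    ShortComplex.exact_of_f_is_kernel _ ((homComplex P Y).homologyIsKernel n j hj)
  have hS' := hS.unop
  rw [ShortComplex.moduleCat_exact_iff] at hS'
  refine (map_eq_zero_iff (leftDerivedIso P Y n).hom.unop.hom h1).trans ?_
  constructor
  · intro h
    obtain ⟨g, hg⟩ := hS' _ h
    refine ⟨g, ?_⟩
    have h5 := congr(((homComplex P Y).pOpcycles n).unop.hom $hg)
    exact (h2 g).symm.trans (h5.trans h3)
  · rintro ⟨g, hg⟩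
    have : (opcyclesToCocycles P Y n).unop.hom z =
        ((homComplex P Y).fromOpcycles n j).unop.hom g := by
      apply hp
      exact h3.trans (hg.symm.trans (h2 g).symm)
    refine (congr(((homComplex P Y).homologyι n).unop.hom $this)).trans ?_
    exact congr(ModuleCat.Hom.hom
      (Quiver.Hom.unop $((homComplex P Y).homologyι_comp_fromOpcycles n j)) g)

lemma classMap_eq_zero_iff (P : ProjectiveResolution X) (n : ℕ) (z : cocycles P Y n) :
    classMap P Y n z = 0 ↔ P.extMk z.1 (n + 1) rfl (mem_cocycles.1 z.2) = 0 := by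
  cases n with
  | succ p =>
    rw [classMap_eq_zero_iff_exists P _ z p (by simp), P.extMk_eq_zero_iff _ _ _ _ p rfl]
  | zero =>
    rw [classMap_eq_zero_iff_exists P _ z 0 (by simp),
      ← P.extEquivCohomologyClass.apply_eq_iff_eq, P.extEquivCohomologyClass_extMk,
      P.extEquivCohomologyClass_zero, CochainComplex.HomComplex.CohomologyClass.mk_eq_zero_iff,
      CochainComplex.HomComplex.Cocycle.toSingleMk_mem_coboundaries_iff _ _ _ _ _ 1 (by lia)]
    have h1 : IsZero (P.cochainComplex.X 1) :=
      P.cochainComplex.isZero_of_isStrictlyLE 0 1 (by lia)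
    constructor
    · rintro ⟨g, hg⟩
      refine ⟨0, ?_⟩
      rw [← hg]
      simp
    · rintro ⟨g, hg⟩
      refine ⟨0, ?_⟩
      rw [h1.eq_of_tgt (P.cochainComplex.d _ 1) 0, zero_comp] at hg
      rw [← cancel_epi (P.cochainComplexXIso (-(0 : ℕ)) 0 rfl).hom, ← hg]
      simp

/-- The class in `Abelian.Ext` of a cocycle, as a linear map. -/
def extMkMap (P : ProjectiveResolution X) (Y : ModuleCat.{u} R) (n : ℕ) :
    cocycles P Y n →ₗ[R] Abelian.Ext X Y n where
  toFun z := P.extMk z.1 (n + 1) rfl (mem_cocycles.1 z.2)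
  map_add' x y := (P.add_extMk _ _ _ _ _ _).symm
  map_smul' r x := by
    rw [RingHom.id_apply, Abelian.Ext.smul_eq_comp_mk₀, P.extMk_comp_mk₀]
    congr 1

lemma extMkMap_surjective (P : ProjectiveResolution X) (Y : ModuleCat.{u} R) (n : ℕ) :
    Function.Surjective (extMkMap P Y n) := by
  intro e
  obtain ⟨f, hf, rfl⟩ := P.extMk_surjective e (n + 1) rfl
  exact ⟨⟨f, hf⟩, rfl⟩

lemma ker_classMap (P : ProjectiveResolution X) (Y : ModuleCat.{u} R) (n : ℕ) :
    LinearMap.ker (classMap P Y n) = LinearMap.ker (extMkMap P Y n) := by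
  ext z
  exact classMap_eq_zero_iff P n z

/-- Linear surjections with the same kernel have isomorphic targets. -/
def equivOfKerEq {A B C : Type*} [AddCommGroup A] [AddCommGroup B] [AddCommGroup C]
    [Module R A] [Module R B] [Module R C] (f : A →ₗ[R] B) (g : A →ₗ[R] C)
    (hf : Function.Surjective f) (hg : Function.Surjective g)
    (h : LinearMap.ker f = LinearMap.ker g) : B ≃ₗ[R] C :=
  (f.quotKerEquivOfSurjective hf).symm ≪≫ₗ Submodule.quotEquivOfEq _ _ h ≪≫ₗ
    g.quotKerEquivOfSurjective hg

lemma equivOfKerEq_apply {A B C : Type*} [AddCommGroup A] [AddCommGroup B] [AddCommGroup C]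
    [Module R A] [Module R B] [Module R C] (f : A →ₗ[R] B) (g : A →ₗ[R] C)
    (hf : Function.Surjective f) (hg : Function.Surjective g)
    (h : LinearMap.ker f = LinearMap.ker g) (a : A) : equivOfKerEq f g hf hg h (f a) = g a := by
  have : (f.quotKerEquivOfSurjective hf).symm (f a) = Submodule.Quotient.mk a := by
    rw [LinearEquiv.symm_apply_eq]
    rfl
  simp only [equivOfKerEq, LinearEquiv.trans_apply, this]
  rfl

/-- The modules `Ext^n(X, Y)` defined by deriving `Hom(-, Y)` and defined in the derived category
are isomorphic. -/
def extEquiv (X Y : ModuleCat.{u} R) (n : ℕ) :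
    ((Ext R (ModuleCat.{u} R) n).obj (op X)).obj Y ≃ₗ[R] Abelian.Ext X Y n :=
  equivOfKerEq (classMap (projectiveResolution X) Y n) (extMkMap (projectiveResolution X) Y n)
    (classMap_surjective _ _ _) (extMkMap_surjective _ _ _) (ker_classMap _ _ _)

lemma extEquiv_naturality (f : X ⟶ X') (Y : ModuleCat.{u} R) (n : ℕ)
    (e : ((Ext R (ModuleCat.{u} R) n).obj (op X')).obj Y) :
    extEquiv X Y n ((((Ext R (ModuleCat.{u} R) n).map f.op).app Y).hom e) =
      (Abelian.Ext.mk₀ f).comp (extEquiv X' Y n e) (zero_add n) := by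
  obtain ⟨z, rfl⟩ := classMap_surjective (projectiveResolution X') Y n e
  let φ : ProjectiveResolution.Hom (projectiveResolution X) (projectiveResolution X') f :=
    { hom := ProjectiveResolution.lift f _ _
      hom_f_zero_comp_π_f_zero := by
        rw [← HomologicalComplex.comp_f, ProjectiveResolution.lift_commutes,
          HomologicalComplex.comp_f] }
  have hz : φ.hom.f n ≫ z.1 ∈ cocycles (projectiveResolution X) Y n := by
    have := mem_cocycles.1 z.2
    rw [mem_cocycles]
    simp [← φ.hom.comm_assoc, this]
  rw [classMap_naturality φ n z hz]
  simp only [extEquiv, equivOfKerEq_apply]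
  exact (ProjectiveResolution.mk₀_comp_extMk z.1 (n + 1) rfl (mem_cocycles.1 z.2) φ).symm

end Comparison

/-! ### Local cohomology as a direct limit -/

section Colimit

variable {R : Type u} [CommRing R]

/-- The projection `R/A → R/B`, for `A ≤ B`. -/
def quotMap {A B : Ideal R} (h : A ≤ B) : ModuleCat.of R (R ⧸ A) ⟶ ModuleCat.of R (R ⧸ B) :=
  ModuleCat.ofHom (Submodule.mapQ A B LinearMap.id h)

lemma quotMap_comp {A B C : Ideal R} (h : A ≤ B) (h' : B ≤ C) :
    quotMap h ≫ quotMap h' = quotMap (h.trans h') := by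
  apply ModuleCat.hom_ext
  apply LinearMap.ext
  intro x
  obtain ⟨y, rfl⟩ := Submodule.mkQ_surjective _ x
  rfl

/-- The colimit cocone computing local cohomology, evaluated at `Y`. -/
def evalCocone (I : Ideal R) (i : ℕ) (Y : ModuleCat.{u} R) :
    Cocone (localCohomology.diagram (localCohomology.idealPowersDiagram I) i ⋙
      (evaluation _ (ModuleCat.{u} R)).obj Y) :=
  ((evaluation (ModuleCat.{u} R) (ModuleCat.{u} R)).obj Y).mapCocone
    (colimit.cocone (localCohomology.diagram (localCohomology.idealPowersDiagram I) i))

/-- Evaluation at `Y` preserves the colimit defining local cohomology. -/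
def evalCoconeIsColimit (I : Ideal R) (i : ℕ) (Y : ModuleCat.{u} R) :
    IsColimit (evalCocone I i Y) :=
  isColimitOfPreserves _ (colimit.isColimit _)

instance (I : Ideal R) (i : ℕ) (Y : ModuleCat.{u} R) :
    PreservesColimit (localCohomology.diagram (localCohomology.idealPowersDiagram I) i ⋙
      (evaluation _ (ModuleCat.{u} R)).obj Y) (forget (ModuleCat.{u} R)) :=
  have : PreservesFilteredColimitsOfSize.{0, 0} (forget (ModuleCat.{u} R)) :=
    preservesFilteredColimitsOfSize_shrink.{0, u, 0, u} _
  inferInstance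

/-- The structure map `Ext^i(R/I^t, R) → H^i_I(R)` of the direct limit, on the `Ext` modules that
define local cohomology. -/
def levelMap (I : Ideal R) (i t : ℕ) : ExtR (ModuleCat.of R (R ⧸ I ^ t)) i →ₗ[R] H I i :=
  ((evalCocone I i (ModuleCat.of R R)).ι.app (op (op t))).hom

/-- The map `Ext^i(R/I^t, R) → H^i_I(R)` into the direct limit, on the `Ext` modules of the derived
category. -/
def ofLevel (I : Ideal R) (i t : ℕ) :
    Abelian.Ext (ModuleCat.of R (R ⧸ I ^ t)) (ModuleCat.of R R) i →ₗ[R] H I i :=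
  levelMap I i t ∘ₗ
    (extEquiv (ModuleCat.of R (R ⧸ I ^ t)) (ModuleCat.of R R) i).symm.toLinearMap

lemma ofLevel_extEquiv (I : Ideal R) (i t : ℕ) (e : ExtR (ModuleCat.of R (R ⧸ I ^ t)) i) :
    ofLevel I i t (extEquiv _ _ i e) = levelMap I i t e :=
  congrArg (levelMap I i t) ((extEquiv _ _ i).symm_apply_apply e)

lemma ofLevel_quotMap (I : Ideal R) (i : ℕ) {s t : ℕ} (h : t ≤ s)
    (e : Abelian.Ext (ModuleCat.of R (R ⧸ I ^ t)) (ModuleCat.of R R) i) :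
    ofLevel I i s ((Abelian.Ext.mk₀ (quotMap (Ideal.pow_le_pow_right h))).comp e (zero_add i)) =
      ofLevel I i t e := by
  obtain ⟨e, rfl⟩ := (extEquiv _ _ _).surjective e
  rw [← extEquiv_naturality, ofLevel_extEquiv, ofLevel_extEquiv]
  have h1 := (evalCocone I i (ModuleCat.of R R)).w
    (show (op (op t) : ℕᵒᵖᵒᵖ) ⟶ op (op s) from (homOfLE h).op.op)
  exact congr(ModuleCat.Hom.hom $h1 e)

/-- Every element of the direct limit comes from a finite level. -/
lemma exists_ofLevel_eq (I : Ideal R) (i : ℕ) (x : H I i) : ∃ t e, ofLevel I i t e = x := by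
  obtain ⟨⟨⟨t⟩⟩, e, he⟩ :=
    Concrete.isColimit_exists_rep _ (evalCoconeIsColimit I i (ModuleCat.of R R)) x
  exact ⟨t, extEquiv _ _ _ e, (ofLevel_extEquiv I i t e).trans he⟩

/-- An element that vanishes in the direct limit vanishes at a finite level. -/
lemma ofLevel_eq_zero (I : Ideal R) (i t : ℕ)
    (e : Abelian.Ext (ModuleCat.of R (R ⧸ I ^ t)) (ModuleCat.of R R) i)
    (he : ofLevel I i t e = 0) :
    ∃ s, ∃ h : t ≤ s,
      (Abelian.Ext.mk₀ (quotMap (Ideal.pow_le_pow_right (I := I) h))).comp e (zero_add i) = 0 := by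
  obtain ⟨e, rfl⟩ := (extEquiv _ _ _).surjective e
  rw [ofLevel_extEquiv] at he
  obtain ⟨⟨⟨s⟩⟩, f, g, hfg⟩ := Concrete.isColimit_exists_of_rep_eq _
    (evalCoconeIsColimit I i (ModuleCat.of R R)) (i := op (op t)) (j := op (op t)) e 0
    (he.trans (map_zero (levelMap I i t)).symm)
  refine ⟨s, leOfHom f.unop.unop, ?_⟩
  rw [← extEquiv_naturality]
  exact (congr(extEquiv _ _ _ $(hfg.trans (map_zero _)))).trans (map_zero _)

lemma incl_ofLevel {J I : Ideal R} (h : J ≤ I) (i t : ℕ)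
    (e : Abelian.Ext (ModuleCat.of R (R ⧸ I ^ t)) (ModuleCat.of R R) i) :
    incl h i (ofLevel I i t e) = ofLevel J i t
      ((Abelian.Ext.mk₀ (quotMap (Ideal.pow_right_mono h t))).comp e (zero_add i)) := by
  obtain ⟨e, rfl⟩ := (extEquiv _ _ _).surjective e
  rw [← extEquiv_naturality, ofLevel_extEquiv, ofLevel_extEquiv]
  have h1 := congr(NatTrans.app $(ι_colimMap (Functor.whiskerRight (NatTrans.op (quotientPowMap h))
    (Ext R (ModuleCat.{u} R) i)) (op (op t))) (ModuleCat.of R R))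
  exact congr(ModuleCat.Hom.hom $h1 e)

end Colimit

/-! ### Long exact sequences of `Ext` modules -/

section LongExact

variable {R : Type u} [CommRing R]

/-- The module `Ext^i_R(M, N)`. -/
abbrev ExtM (R : Type u) [CommRing R] (M N : Type u) [AddCommGroup M] [Module R M]
    [AddCommGroup N] [Module R N] (i : ℕ) : Type u :=
  Abelian.Ext (ModuleCat.of R M) (ModuleCat.of R N) i

variable {A B C Y : Type u} [AddCommGroup A] [AddCommGroup B] [AddCommGroup C] [AddCommGroup Y]
  [Module R A] [Module R B] [Module R C] [Module R Y]

/-- The map `Ext^i(B, Y) → Ext^i(A, Y)` induced by `f : A → B`. -/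
def pre (f : A →ₗ[R] B) (Y : Type u) [AddCommGroup Y] [Module R Y] (i : ℕ) :
    ExtM R B Y i →ₗ[R] ExtM R A Y i :=
  (Abelian.Ext.mk₀ (ModuleCat.ofHom f)).precompOfLinear R (ModuleCat.of R Y) (zero_add i)

/-- The map `Ext^i(Y, A) → Ext^i(Y, B)` induced by `f : A → B`. -/
def post (f : A →ₗ[R] B) (Y : Type u) [AddCommGroup Y] [Module R Y] (i : ℕ) :
    ExtM R Y A i →ₗ[R] ExtM R Y B i :=
  (Abelian.Ext.mk₀ (ModuleCat.ofHom f)).postcompOfLinear R (ModuleCat.of R Y) (add_zero i)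

lemma pre_apply (f : A →ₗ[R] B) (i : ℕ) (e : ExtM R B Y i) :
    pre f Y i e = (Abelian.Ext.mk₀ (ModuleCat.ofHom f)).comp e (zero_add i) := rfl

lemma pre_comp (f : A →ₗ[R] B) (g : B →ₗ[R] C) (i : ℕ) (e : ExtM R C Y i) :
    pre (g ∘ₗ f) Y i e = pre f Y i (pre g Y i e) := by
  simp only [pre_apply, ModuleCat.ofHom_comp, Abelian.Ext.mk₀_comp_mk₀_assoc]

lemma pre_id (i : ℕ) (e : ExtM R A Y i) : pre LinearMap.id Y i e = e := by
  simp only [pre_apply, ModuleCat.ofHom_id, Abelian.Ext.mk₀_id_comp]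

lemma pre_smul (f : A →ₗ[R] B) (r : R) (i : ℕ) (e : ExtM R B Y i) :
    pre (r • f) Y i e = r • pre f Y i e := by
  have : ModuleCat.ofHom (r • f) = r • ModuleCat.ofHom f := rfl
  simp only [pre_apply, this, Abelian.Ext.mk₀_smul, Abelian.Ext.smul_comp]

lemma pre_add (f g : A →ₗ[R] B) (i : ℕ) (e : ExtM R B Y i) :
    pre (f + g) Y i e = pre f Y i e + pre g Y i e := by
  have : ModuleCat.ofHom (f + g) = ModuleCat.ofHom f + ModuleCat.ofHom g := rfl
  simp only [pre_apply, this, Abelian.Ext.mk₀_add, Abelian.Ext.add_comp]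

lemma pre_zero (i : ℕ) (e : ExtM R B Y i) : pre (0 : A →ₗ[R] B) Y i e = 0 := by
  have : ModuleCat.ofHom (0 : A →ₗ[R] B) = 0 := rfl
  simp only [pre_apply, this, Abelian.Ext.mk₀_zero, Abelian.Ext.zero_comp]

lemma pre_injective_of_leftInverse {f : A →ₗ[R] B} {g : B →ₗ[R] A} (h : f ∘ₗ g = LinearMap.id)
    (i : ℕ) : Function.Injective (pre f Y i) := by
  intro x y hxy
  have := congr(pre g Y i $hxy)
  rwa [← pre_comp, ← pre_comp, h, pre_id, pre_id] at this

lemma pre_surjective_of_rightInverse {f : A →ₗ[R] B} {g : B →ₗ[R] A} (h : g ∘ₗ f = LinearMap.id)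
    (i : ℕ) : Function.Surjective (pre f Y i) := by
  intro x
  exact ⟨pre g Y i x, by rw [← pre_comp, h, pre_id]⟩

lemma pre_bijective_of_equiv (f : A ≃ₗ[R] B) (i : ℕ) :
    Function.Bijective (pre (f : A →ₗ[R] B) Y i) :=
  ⟨pre_injective_of_leftInverse (g := f.symm) (by ext; simp) i,
    pre_surjective_of_rightInverse (g := f.symm) (by ext; simp) i⟩

lemma post_apply (f : A →ₗ[R] B) (i : ℕ) (e : ExtM R Y A i) :
    post f Y i e = e.comp (Abelian.Ext.mk₀ (ModuleCat.ofHom f)) (add_zero i) := rfl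

/-- The composite `A → B → C` is a short exact sequence. -/
structure IsShortExact (f : A →ₗ[R] B) (g : B →ₗ[R] C) : Prop where
  injective : Function.Injective f
  exact : Function.Exact f g
  surjective : Function.Surjective g

namespace IsShortExact

lemma of_mkQ (N : Submodule R A) : IsShortExact N.subtype N.mkQ where
  injective := N.injective_subtype
  exact := LinearMap.exact_subtype_mkQ N
  surjective := N.mkQ_surjective

lemma of_range_mkQ {f : A →ₗ[R] B} (hf : Function.Injective f) :
    IsShortExact f (LinearMap.range f).mkQ where
  injective := hf
  exact := f.exact_map_mkQ_range
  surjective := Submodule.mkQ_surjective _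

lemma of_isSMulRegular {x : R} (hx : IsSMulRegular A x) :
    IsShortExact (LinearMap.lsmul R A x) (x • (⊤ : Submodule R A)).mkQ where
  injective := hx
  exact := LinearMap.exact_lsmul_mkQ_smul_top A x
  surjective := Submodule.mkQ_surjective _

variable {f : A →ₗ[R] B} {g : B →ₗ[R] C}

lemma shortExact (h : IsShortExact f g) :
    (ModuleCat.shortComplexOfCompEqZero f g h.exact.linearMap_comp_eq_zero).ShortExact :=
  ModuleCat.shortComplex_shortExact _ h.exact h.injective h.surjective

variable (Y) (i : ℕ)

/-- The connecting map `Ext^i(A, Y) → Ext^{i+1}(C, Y)` of a short exact sequence. -/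
def δ (h : IsShortExact f g) : ExtM R A Y i →ₗ[R] ExtM R C Y (i + 1) :=
  h.shortExact.extClass.precompOfLinear R (ModuleCat.of R Y) (add_comm 1 i)

/-- The connecting map `Ext^i(Y, C) → Ext^{i+1}(Y, A)` of a short exact sequence. -/
def δ' (h : IsShortExact f g) : ExtM R Y C i →ₗ[R] ExtM R Y A (i + 1) :=
  h.shortExact.extClass.postcompOfLinear R (ModuleCat.of R Y) rfl

variable {Y} {i}

lemma exists_pre_of_pre_eq_zero (h : IsShortExact f g) (e : ExtM R B Y i) (he : pre f Y i e = 0) :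
    ∃ e', pre g Y i e' = e :=
  Abelian.Ext.contravariant_sequence_exact₂ h.shortExact _ e he

lemma exists_pre_of_δ_eq_zero (h : IsShortExact f g) (e : ExtM R A Y i) (he : h.δ Y i e = 0) :
    ∃ e', pre f Y i e' = e :=
  Abelian.Ext.contravariant_sequence_exact₁ h.shortExact _ e (add_comm 1 i) he

lemma exists_δ_of_pre_eq_zero (h : IsShortExact f g) (e : ExtM R C Y (i + 1))
    (he : pre g Y (i + 1) e = 0) :
    ∃ e', h.δ Y i e' = e :=
  Abelian.Ext.contravariant_sequence_exact₃ h.shortExact _ e he (add_comm 1 i)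

lemma exists_post_of_δ'_eq_zero (h : IsShortExact f g) (e : ExtM R Y C i) (he : h.δ' Y i e = 0) :
    ∃ e', post g Y i e' = e :=
  Abelian.Ext.covariant_sequence_exact₃ _ h.shortExact e rfl he

lemma exists_δ'_of_post_eq_zero (h : IsShortExact f g) (e : ExtM R Y A (i + 1))
    (he : post f Y (i + 1) e = 0) :
    ∃ e', h.δ' Y i e' = e :=
  Abelian.Ext.covariant_sequence_exact₁ _ h.shortExact e he rfl

lemma subsingleton_mid (h : IsShortExact f g) (h₁ : Subsingleton (ExtM R A Y i))
    (h₃ : Subsingleton (ExtM R C Y i)) :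
    Subsingleton (ExtM R B Y i) := by
  refine subsingleton_of_forall_eq 0 fun e ↦ ?_
  obtain ⟨e', rfl⟩ := h.exists_pre_of_pre_eq_zero e (Subsingleton.elim _ _)
  rw [Subsingleton.elim e' 0, map_zero]

lemma subsingleton_right (h : IsShortExact f g) (h₁ : Subsingleton (ExtM R A Y i))
    (h₂ : Subsingleton (ExtM R B Y (i + 1))) : Subsingleton (ExtM R C Y (i + 1)) := by
  refine subsingleton_of_forall_eq 0 fun e ↦ ?_
  obtain ⟨e', rfl⟩ := h.exists_δ_of_pre_eq_zero e (Subsingleton.elim _ _)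
  rw [Subsingleton.elim e' 0, map_zero]

lemma subsingleton_left (h : IsShortExact f g) (h₂ : Subsingleton (ExtM R B Y i))
    (h₃ : Subsingleton (ExtM R C Y (i + 1))) : Subsingleton (ExtM R A Y i) := by
  refine subsingleton_of_forall_eq 0 fun e ↦ ?_
  obtain ⟨e', rfl⟩ := h.exists_pre_of_δ_eq_zero e (Subsingleton.elim _ _)
  rw [Subsingleton.elim e' 0, map_zero]

lemma δ'_post (h : IsShortExact f g) (e : ExtM R Y B i) : h.δ' Y i (post g Y i e) = 0 := by
  change (e.comp (Abelian.Ext.mk₀ _) (add_zero i)).comp h.shortExact.extClass rfl = 0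
  rw [Abelian.Ext.comp_assoc_of_second_deg_zero, h.shortExact.comp_extClass, Abelian.Ext.comp_zero]

lemma pre_δ' (h : IsShortExact f g) {Y' : Type u} [AddCommGroup Y'] [Module R Y']
    (k : Y' →ₗ[R] Y) (e : ExtM R Y C i) :
    pre k A (i + 1) (h.δ' Y i e) = h.δ' Y' i (pre k C i e) := by
  change (Abelian.Ext.mk₀ _).comp (e.comp h.shortExact.extClass rfl) (zero_add _) =
    ((Abelian.Ext.mk₀ _).comp e (zero_add i)).comp h.shortExact.extClass rfl
  rw [Abelian.Ext.comp_assoc _ _ _ _ _ (by lia)]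

end IsShortExact

lemma pre_post {Z : Type u} [AddCommGroup Z] [Module R Z] (k : A →ₗ[R] B) (l : Y →ₗ[R] Z) (i : ℕ)
    (e : ExtM R B Y i) : pre k Z i (post l B i e) = post l A i (pre k Y i e) := by
  simp only [pre_apply, post_apply]
  rw [Abelian.Ext.comp_assoc _ _ _ _ _ (by lia)]

lemma pre_lsmul (x : R) (i : ℕ) (e : ExtM R A Y i) :
    pre (LinearMap.lsmul R A x) Y i e = x • e := by
  have : LinearMap.lsmul R A x = x • LinearMap.id := by ext; simp
  rw [this, pre_smul, pre_id]

/-- `Ext^0` is `Hom`. -/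
def homEquiv (A Y : Type u) [AddCommGroup A] [Module R A] [AddCommGroup Y] [Module R Y] :
    (A →ₗ[R] Y) ≃ₗ[R] ExtM R A Y 0 :=
  (Abelian.Ext.linearEquiv₀.trans ModuleCat.homLinearEquiv).symm

lemma homEquiv_apply (f : A →ₗ[R] Y) :
    homEquiv A Y f = Abelian.Ext.mk₀ (ModuleCat.ofHom f) := rfl

lemma pre_homEquiv (f : A →ₗ[R] B) (g : B →ₗ[R] Y) :
    pre f Y 0 (homEquiv B Y g) = homEquiv A Y (g ∘ₗ f) := by
  simp only [pre_apply, homEquiv_apply, ModuleCat.ofHom_comp, Abelian.Ext.mk₀_comp_mk₀]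

lemma post_homEquiv (f : A →ₗ[R] B) (g : Y →ₗ[R] A) :
    post f Y 0 (homEquiv Y A g) = homEquiv Y B (f ∘ₗ g) := by
  simp only [post_apply, homEquiv_apply, ModuleCat.ofHom_comp, Abelian.Ext.mk₀_comp_mk₀]

lemma subsingleton_ext_zero_iff : Subsingleton (ExtM R A Y 0) ↔ Subsingleton (A →ₗ[R] Y) :=
  (homEquiv A Y).symm.toEquiv.subsingleton_congr

end LongExact

/-! ### Annihilation and vanishing of `Ext` modules -/

section Nakayama

variable {R : Type u} [CommRing R] {M Y : Type u} [AddCommGroup M] [Module R M]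
  [AddCommGroup Y] [Module R Y]

/-- If `s` kills `Ext^{i+1}(M/xM, Y)` then `s Ext^i(M, Y) ⊆ x Ext^i(M, Y)`. -/
lemma exists_smul_eq_of_kills {x s : R} (hx : IsSMulRegular M x) (i : ℕ)
    (hs : ∀ e : ExtM R (M ⧸ x • (⊤ : Submodule R M)) Y (i + 1), s • e = 0) (e : ExtM R M Y i) :
    ∃ e' : ExtM R M Y i, s • e = x • e' := by
  obtain ⟨e', he'⟩ := (IsShortExact.of_isSMulRegular hx).exists_pre_of_δ_eq_zero (s • e)
    (by rw [map_smul]; exact hs _)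
  exact ⟨e', by rw [← he', pre_lsmul]⟩

variable [IsNoetherianRing R]

/-- Annihilation of `Ext^i(M, Y)` by an element of `S` is inherited from the quotients `R/p` by the
primes `p` in the support of `M`. -/
lemma exists_mem_kills_of_forall_prime (S : Submonoid R) (i : ℕ) [Module.Finite R M]
    (h : ∀ p : Ideal R, p.IsPrime → Module.annihilator R M ≤ p →
      ∃ s ∈ S, ∀ e : ExtM R (R ⧸ p) Y i, s • e = 0) :
    ∃ s ∈ S, ∀ e : ExtM R M Y i, s • e = 0 := by
  induction ‹Module.Finite R M› using
    IsNoetherianRing.induction_on_isQuotientEquivQuotientPrime R with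
  | subsingleton N =>
    refine ⟨1, S.one_mem, fun e ↦ ?_⟩
    have h0 : (LinearMap.id : N →ₗ[R] N) = 0 := by ext x; exact Subsingleton.elim _ _
    rw [one_smul, ← pre_id i e, h0, pre_zero]
  | quotient N p f =>
    obtain ⟨s, hs, hse⟩ := h p.1 p.2 (by rw [f.annihilator_eq, Ideal.annihilator_quotient])
    refine ⟨s, hs, fun e ↦ ?_⟩
    obtain ⟨e', rfl⟩ := (pre_bijective_of_equiv f i).2 e
    rw [← map_smul, hse, map_zero]
  | exact N₁ N₂ N₃ f g hf hg hfg h₁ h₃ =>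
    obtain ⟨s₁, hs₁, hse₁⟩ := h₁ fun p hp hle ↦
      h p hp ((f.annihilator_le_of_injective hf).trans hle)
    obtain ⟨s₃, hs₃, hse₃⟩ := h₃ fun p hp hle ↦
      h p hp ((g.annihilator_le_of_surjective hg).trans hle)
    have H : IsShortExact f g := ⟨hf, hfg, hg⟩
    refine ⟨s₃ * s₁, S.mul_mem hs₃ hs₁, fun e ↦ ?_⟩
    obtain ⟨e', he'⟩ := H.exists_pre_of_pre_eq_zero (s₁ • e) (by rw [map_smul, hse₁])
    rw [mul_smul, ← he', ← map_smul, hse₃, map_zero]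

/-- Vanishing of `Ext^i(M, Y)` can be tested on the quotients `R/p` by the primes `p` in the support
of `M`. -/
lemma subsingleton_ext_of_forall_prime (i : ℕ) [Module.Finite R M]
    (h : ∀ p : Ideal R, p.IsPrime → Module.annihilator R M ≤ p →
      Subsingleton (ExtM R (R ⧸ p) Y i)) : Subsingleton (ExtM R M Y i) := by
  obtain ⟨s, hs, hse⟩ := exists_mem_kills_of_forall_prime (M := M) (Y := Y) ⊥ i fun p hp hle ↦
    ⟨1, Submonoid.one_mem _, fun e ↦ (h p hp hle).elim _ _⟩
  obtain rfl := Submonoid.mem_bot.1 hs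
  exact subsingleton_of_forall_eq 0 fun e ↦ by simpa using hse e

/-- If `x` is a nonzerodivisor on `M` in the maximal ideal, then `Ext^{i+1}(M/xM, Y) = 0` makes
multiplication by `x` on `Ext^i(M, Y)` surjective, and Nakayama's lemma applies. -/
lemma subsingleton_ext_of_isSMulRegular [IsLocalRing R] [Module.Finite R M] [Module.Finite R Y]
    {x : R} (hxm : x ∈ IsLocalRing.maximalIdeal R) (hx : IsSMulRegular M x) (i : ℕ)
    (h : Subsingleton (ExtM R (M ⧸ x • (⊤ : Submodule R M)) Y (i + 1))) :
    Subsingleton (ExtM R M Y i) := by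
  have : (⊤ : Submodule R (ExtM R M Y i)) = ⊥ := by
    apply Submodule.eq_bot_of_le_smul_of_le_jacobson_bot (Ideal.span {x}) _
      Module.Finite.fg_top
    · intro e _
      obtain ⟨e', he'⟩ := exists_smul_eq_of_kills (s := 1) hx i (fun e ↦ Subsingleton.elim _ _) e
      rw [one_smul] at he'
      rw [he']
      exact Submodule.smul_mem_smul (Ideal.mem_span_singleton_self x) trivial
    · rw [IsLocalRing.jacobson_eq_maximalIdeal _ bot_ne_top, Ideal.span_singleton_le_iff_mem]
      exact hxm
  exact subsingleton_of_forall_eq 0 fun e ↦ (Submodule.mem_bot R).1 (this ▸ trivial)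

end Nakayama

/-! ### Nonvanishing in the degree of the height -/

section Bass

variable {R : Type u} [CommRing R]

lemma isSMulRegular_quotient_prime {p : Ideal R} [p.IsPrime] {x : R} (hx : x ∉ p) :
    IsSMulRegular (R ⧸ p) x := by
  intro a b hab
  have h0 : algebraMap R (R ⧸ p) x ≠ 0 := by
    rwa [Ne, Ideal.Quotient.algebraMap_eq, Ideal.Quotient.eq_zero_iff_mem]
  simp only [Algebra.smul_def] at hab
  exact mul_left_cancel₀ h0 hab

lemma le_annihilator_quotient_smul_top (p : Ideal R) (x : R) :
    p ⊔ Ideal.span {x} ≤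
      Module.annihilator R ((R ⧸ p) ⧸ x • (⊤ : Submodule R (R ⧸ p))) := by
  refine sup_le ?_ ?_
  · refine le_trans ?_ (LinearMap.annihilator_le_of_surjective
      (x • (⊤ : Submodule R (R ⧸ p))).mkQ (Submodule.mkQ_surjective _))
    rw [Ideal.annihilator_quotient]
  · rw [Ideal.span_singleton_le_iff_mem, Module.mem_annihilator]
    intro m
    obtain ⟨y, rfl⟩ := Submodule.mkQ_surjective _ m
    rw [← map_smul, Submodule.mkQ_apply, Submodule.Quotient.mk_eq_zero]
    exact Submodule.smul_mem_pointwise_smul _ _ _ trivial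

/-- The localization of `Ext^i(R/p, R)` at the prime `p` is nonzero: only elements of `p` can
annihilate `Ext^i(R/p, R)`. -/
def ExtLocNonzero (p : Ideal R) (i : ℕ) : Prop :=
  ∀ s : R, (∀ e : ExtM R (R ⧸ p) R i, s • e = 0) → s ∈ p

lemma ExtLocNonzero.nontrivial {p : Ideal R} [hp : p.IsPrime] {i : ℕ} (h : ExtLocNonzero p i) :
    Nontrivial (ExtM R (R ⧸ p) R i) := by
  by_contra hn
  rw [not_nontrivial_iff_subsingleton] at hn
  exact hp.ne_top ((Ideal.eq_top_iff_one _).2 (h 1 fun e ↦ Subsingleton.elim _ _))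

lemma smul_ext_eq_zero_of_mem {Y : Type u} [AddCommGroup Y] [Module R Y] {p : Ideal R} {t : R}
    (ht : t ∈ p) (i : ℕ) (e : ExtM R (R ⧸ p) Y i) : t • e = 0 := by
  have : LinearMap.lsmul R (R ⧸ p) t = 0 := by
    ext
    have : t • (Submodule.Quotient.mk 1 : R ⧸ p) = 0 := by
      rw [← Submodule.Quotient.mk_smul, Submodule.Quotient.mk_eq_zero]
      simpa using ht
    simpa using this
  rw [← pre_lsmul, this, pre_zero]

variable [IsNoetherianRing R]

/-- A minimal prime is an associated prime of `R`, so `R/p` embeds into `R`. -/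
lemma extLocNonzero_zero {p : Ideal R} (hp : p ∈ minimalPrimes R) : ExtLocNonzero p 0 := by
  have h1 : p ∈ associatedPrimes R R := by
    apply Module.associatedPrimes.minimalPrimes_annihilator_subset_associatedPrimes
    have : Module.annihilator R R = ⊥ := by
      rw [Module.annihilator_eq_bot]
      infer_instance
    rwa [this]
  obtain ⟨hprime, x, hx⟩ := Submodule.isAssociatedPrime_iff.1 h1
  have hx' : ∀ r, r ∈ p ↔ r * x = 0 := fun r ↦ by
    rw [hx, Submodule.mem_colon_singleton, Submodule.mem_bot, smul_eq_mul]
  intro s hs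
  have h2 := hs (homEquiv _ _ (p.liftQ (LinearMap.toSpanSingleton R R x) fun r hr ↦ (hx' r).1 hr))
  rw [← map_smul, map_eq_zero_iff _ (homEquiv _ _).injective] at h2
  have h3 : s • ((1 : R) • x) = 0 := LinearMap.congr_fun h2 (Submodule.Quotient.mk 1)
  rw [hx']
  simpa using h3

/-- Bass's lemma: if `p ⊂ q` are consecutive primes and `Ext^i(R/p, R)` is nonzero at `p`, then
`Ext^{i+1}(R/q, R)` is nonzero at `q`. -/
lemma ExtLocNonzero.succ {p q : Ideal R} [p.IsPrime] [q.IsPrime] (hpq : p < q)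
    (hcov : ∀ q' : Ideal R, q'.IsPrime → p < q' → q' ≤ q → q' = q) {i : ℕ}
    (h : ExtLocNonzero p i) : ExtLocNonzero q (i + 1) := by
  intro s hs
  by_contra hsq
  obtain ⟨x, hxq, hxp⟩ := SetLike.exists_of_lt hpq
  have hxreg := isSMulRegular_quotient_prime hxp
  obtain ⟨s', hs'q, hs'⟩ := exists_mem_kills_of_forall_prime
    (M := (R ⧸ p) ⧸ x • (⊤ : Submodule R (R ⧸ p))) (Y := R) q.primeCompl (i + 1) (by
      intro q' hq' hle
      have hle' := (le_annihilator_quotient_smul_top p x).trans hle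
      by_cases hq'q : q' ≤ q
      · have hpq' : p < q' := lt_of_le_of_ne (le_sup_left.trans hle') fun hpq' ↦
          hxp (hpq' ▸ hle' (Ideal.mem_sup_right (Ideal.mem_span_singleton_self x)))
        obtain rfl := hcov q' hq' hpq' hq'q
        exact ⟨s, hsq, hs⟩
      · obtain ⟨t, htq', htq⟩ := SetLike.not_le_iff_exists.1 hq'q
        exact ⟨t, htq, fun e ↦ smul_ext_eq_zero_of_mem htq' _ e⟩)
  -- `s'` multiplies the finite module `Ext^i(R/p, R)` into its multiple by `x`, so some element
  -- congruent to a power of `s'` modulo `x` annihilates it.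
  obtain ⟨P, hP, -, hcoeff, hPs⟩ :=
    LinearMap.exists_monic_and_natDegree_eq_and_coeff_mem_pow_and_aeval_eq_zero R
      (algebraMap R (Module.End R (ExtM R (R ⧸ p) R i)) s') (Ideal.span {x}) (by
        rintro _ ⟨e, rfl⟩
        obtain ⟨e', he'⟩ := exists_smul_eq_of_kills hxreg i hs' e
        rw [Module.algebraMap_end_apply, he']
        exact Submodule.smul_mem_smul (Ideal.mem_span_singleton_self x) trivial)
  rw [Polynomial.aeval_algebraMap_apply] at hPs
  have hr : Polynomial.aeval s' P ∈ q := hpq.le (h _ fun e ↦ by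
    simpa [Module.algebraMap_end_apply] using LinearMap.congr_fun hPs e)
  rw [Polynomial.aeval_eq_sum_range, Finset.sum_range_succ, Polynomial.Monic.coeff_natDegree hP,
    one_smul] at hr
  have hr' : ∑ k ∈ Finset.range P.natDegree, P.coeff k • s' ^ k ∈ q := by
    refine Ideal.sum_mem _ fun k hk ↦ ?_
    have hk' : P.natDegree - k ≠ 0 := by
      have := Finset.mem_range.1 hk
      lia
    have : P.coeff k ∈ q := ((Ideal.span_singleton_le_iff_mem _).2 hxq)
      (Ideal.pow_le_self hk' (hcoeff k))
    exact Ideal.mul_mem_right _ _ this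
  exact hs'q (Ideal.IsPrime.mem_of_pow_mem ‹_› _ ((Ideal.add_mem_iff_right _ hr').1 hr))

/-- The Bass numbers of `R` at `p` in degree `height p` are nonzero. -/
theorem extLocNonzero_of_height_eq (n : ℕ) (p : PrimeSpectrum R) (hp : Order.height p = n) :
    ExtLocNonzero p.asIdeal n := by
  induction n generalizing p with
  | zero =>
    refine extLocNonzero_zero ?_
    rw [← Ideal.height_eq_zero_iff, PrimeSpectrum.height_eq_orderHeight, hp, Nat.cast_zero]
  | succ n ih =>
    obtain ⟨-, ⟨y, hyp, hy⟩, hle⟩ := Order.height_eq_coe_add_one_iff.1 hp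
    refine (ih y hy).succ hyp fun q hq hyq hqp ↦ ?_
    by_contra hne
    have h1 := hle ⟨q, hq⟩ (lt_of_le_of_ne hqp fun h ↦ hne congr(PrimeSpectrum.asIdeal $h))
    have h2 := Order.height_add_one_le (a := y) (b := ⟨q, hq⟩) hyq
    rw [hy] at h2
    have := h2.trans h1
    norm_cast at this
    lia

end Bass

/-! ### Vanishing below the codimension over Gorenstein rings -/

section Gorenstein

variable {R : Type u} [CommRing R]

lemma post_lsmul {A Y : Type u} [AddCommGroup A] [Module R A] [AddCommGroup Y] [Module R Y]
    (x : R) (i : ℕ) (e : ExtM R Y A i) : post (LinearMap.lsmul R A x) Y i e = x • e := by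
  rw [Abelian.Ext.smul_eq_comp_mk₀]
  rfl

variable [IsLocalGorenstein R]

open IsLocalRing

variable (R) in
/-- `R` has finite injective dimension. -/
lemma exists_forall_subsingleton_ext : ∃ d : ℕ, ∀ (M : Type u) [AddCommGroup M] [Module R M]
    (i : ℕ), d ≤ i → Subsingleton (ExtM R M R i) := by
  obtain ⟨n, hn⟩ := (injectiveDimension_ne_top_iff _).1
    (IsLocalGorenstein.finite_injectiveDimension (R := R)).ne
  exact ⟨n + 1, fun M _ _ i hi ↦ hn.subsingleton _ _ i hi _⟩

lemma extLocNonzero_of_height {p : Ideal R} [hp : p.IsPrime] {n : ℕ} (h : p.height = n) :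
    ExtLocNonzero p n :=
  extLocNonzero_of_height_eq n ⟨p, hp⟩ (by rw [← PrimeSpectrum.height_eq_orderHeight, h])

variable (R) in
/-- The last nonvanishing `Ext^n(-, R)` on finitely generated modules is detected by the residue
field. -/
lemma exists_last_ext : ∃ n : ℕ,
    (∀ (M : Type u) [AddCommGroup M] [Module R M] [Module.Finite R M] (i : ℕ), n < i →
      Subsingleton (ExtM R M R i)) ∧ Nontrivial (ExtM R (R ⧸ maximalIdeal R) R n) := by
  classical
  let P : ℕ → Prop := fun d ↦ ∀ (M : Type u) [AddCommGroup M] [Module R M] [Module.Finite R M]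
    (i : ℕ), d ≤ i → Subsingleton (ExtM R M R i)
  have hP : ∃ d, P d := by
    obtain ⟨d, hd⟩ := exists_forall_subsingleton_ext R
    exact ⟨d, fun M _ _ _ i hi ↦ hd M i hi⟩
  have hd : P (Nat.find hP) := Nat.find_spec hP
  have hmin : ∀ m < Nat.find hP, ¬ P m := fun m hm ↦ Nat.find_min hP hm
  generalize Nat.find hP = d at hd hmin
  cases d with
  | zero =>
    obtain ⟨h, hh⟩ := ENat.ne_top_iff_exists.1
      (Ideal.height_ne_top_of_isPrime (I := maximalIdeal R))
    exact absurd (hd _ h (Nat.zero_le _))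
      (not_subsingleton_iff_nontrivial.2 (extLocNonzero_of_height hh.symm).nontrivial)
  | succ n =>
    refine ⟨n, fun M _ _ _ i hi ↦ hd M i hi, ?_⟩
    have h1 := hmin n (Nat.lt_succ_self n)
    simp only [P, not_forall] at h1
    obtain ⟨M, _, _, _, i, hi, hM⟩ := h1
    obtain rfl : i = n := by
      by_contra hne
      exact hM (hd M i (by lia))
    by_contra hk
    rw [not_nontrivial_iff_subsingleton] at hk
    refine hM (subsingleton_ext_of_forall_prime _ fun p hp _ ↦ ?_)
    by_cases hpm : p = maximalIdeal R
    · exact hpm ▸ hk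
    · obtain ⟨x, hxm, hxp⟩ := SetLike.exists_of_lt
        (lt_of_le_of_ne (le_maximalIdeal hp.ne_top) hpm)
      exact subsingleton_ext_of_isSMulRegular hxm (isSMulRegular_quotient_prime hxp) _
        (hd _ _ le_rfl)

/-- Let `n` be the last degree in which `Ext(-, R)` is nonzero. If `k` embeds into `M`, then
`Ext^n(M, R) → Ext^n(k, R)` is surjective, so `Ext^n(M, R) ≠ 0`. -/
lemma le_of_nontrivial_hom
    {n : ℕ}
    (hn : ∀ (M : Type u) [AddCommGroup M] [Module R M] [Module.Finite R M] (i : ℕ), n < i →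
      Subsingleton (ExtM R M R i)) (hk : Nontrivial (ExtM R (R ⧸ maximalIdeal R) R n))
    (M : Type u) [AddCommGroup M] [Module R M] [Module.Finite R M] (j : ℕ)
    (hj : ∀ i, j < i → Subsingleton (ExtM R M R i))
    (h0 : Nontrivial ((R ⧸ maximalIdeal R) →ₗ[R] M)) : n ≤ j := by
  obtain ⟨f, hf⟩ := exists_ne (0 : (R ⧸ maximalIdeal R) →ₗ[R] M)
  have : IsSimpleModule R (R ⧸ maximalIdeal R) :=
    isSimpleModule_iff_quot_maximal.2 ⟨_, inferInstance, ⟨LinearEquiv.refl _ _⟩⟩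
  have hfi : Function.Injective f := (LinearMap.injective_or_eq_zero f).resolve_right hf
  by_contra hlt
  refine not_subsingleton_iff_nontrivial.2 hk ?_
  exact (IsShortExact.of_range_mkQ hfi).subsingleton_left (hj n (by lia)) (hn _ _ (by lia))

/-- Let `n` be the last degree in which `Ext(-, R)` is nonzero. If `Ext^s(k, M) ≠ 0`, then cutting
`M` down by a regular sequence of length at most `s` gives a module containing `k`; hence
`Ext^j(M, R) ≠ 0` for some `j ≥ n - s`. -/
lemma le_add_of_nontrivial_ext
    {n : ℕ}
    (hn : ∀ (M : Type u) [AddCommGroup M] [Module R M] [Module.Finite R M] (i : ℕ), n < i →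
      Subsingleton (ExtM R M R i)) (hk : Nontrivial (ExtM R (R ⧸ maximalIdeal R) R n))
    (s : ℕ) (M : Type u) [AddCommGroup M] [Module R M] [Module.Finite R M] (j : ℕ)
    (hj : ∀ i, j < i → Subsingleton (ExtM R M R i))
    (hs : Nontrivial (ExtM R (R ⧸ maximalIdeal R) M s)) : n ≤ j + s := by
  induction s generalizing M j with
  | zero => exact le_of_nontrivial_hom hn hk M j hj (homEquiv _ _).toEquiv.nontrivial
  | succ s ih =>
    by_cases h0 : Subsingleton ((R ⧸ maximalIdeal R) →ₗ[R] M)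
    · obtain ⟨x, hxm, hx⟩ := IsSMulRegular.subsingleton_linearMap_iff.1 h0
      rw [Ideal.annihilator_quotient] at hxm
      have H := IsShortExact.of_isSMulRegular hx
      have := ih (M ⧸ x • (⊤ : Submodule R M)) (j + 1) (fun i hi ↦ by
        obtain ⟨i, rfl⟩ : ∃ i', i = i' + 1 := ⟨i - 1, by lia⟩
        exact H.subsingleton_right (hj i (by lia)) (hj _ (by lia))) (by
        by_contra hne
        rw [not_nontrivial_iff_subsingleton] at hne
        refine not_subsingleton_iff_nontrivial.2 hs (subsingleton_of_forall_eq 0 fun e ↦ ?_)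
        obtain ⟨e', rfl⟩ := H.exists_δ'_of_post_eq_zero e (by
          rw [post_lsmul, smul_ext_eq_zero_of_mem hxm])
        rw [Subsingleton.elim e' 0, map_zero])
      lia
    · exact (le_of_nontrivial_hom hn hk M j hj (not_subsingleton_iff_nontrivial.1 h0)).trans
        (Nat.le_add_right _ _)

/-- The depth of `R` is at least its dimension. -/
lemma subsingleton_ext_residueField {i : ℕ} (hi : i < (maximalIdeal R).height) :
    Subsingleton (ExtM R (R ⧸ maximalIdeal R) R i) := by
  obtain ⟨n, hn, hk⟩ := exists_last_ext R
  obtain ⟨h, hh⟩ := ENat.ne_top_iff_exists.1 (Ideal.height_ne_top_of_isPrime (I := maximalIdeal R))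
  rw [← hh, Nat.cast_lt] at hi
  by_contra hne
  rw [not_subsingleton_iff_nontrivial] at hne
  have h1 := le_add_of_nontrivial_ext hn hk i R 0 (fun k hk ↦ by
    obtain ⟨k, rfl⟩ : ∃ k', k = k' + 1 := ⟨k - 1, by lia⟩
    exact subsingleton_of_forall_eq 0 fun e ↦ Abelian.Ext.eq_zero_of_projective e) hne
  refine not_subsingleton_iff_nontrivial.2
    (extLocNonzero_of_height hh.symm).nontrivial (hn _ h (by lia))

/-- Noetherian induction on `p`, with the maximal ideal as the starting point: for `x ∉ p` in the
maximal ideal, `(R/p)/x` is supported at larger primes. -/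
lemma subsingleton_ext_quotient_prime (p : Ideal R) (hp : p.IsPrime) {i : ℕ} (hi : i < p.height) :
    Subsingleton (ExtM R (R ⧸ p) R i) := by
  induction p using WellFoundedGT.induction generalizing i with
  | ind p ih =>
    by_cases hpm : p = maximalIdeal R
    · subst hpm
      exact subsingleton_ext_residueField hi
    · obtain ⟨x, hxm, hxp⟩ := SetLike.exists_of_lt
        (lt_of_le_of_ne (le_maximalIdeal hp.ne_top) hpm)
      refine subsingleton_ext_of_isSMulRegular hxm (isSMulRegular_quotient_prime hxp) _
        (subsingleton_ext_of_forall_prime _ fun q hq hle ↦ ?_)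
      have hle' := (le_annihilator_quotient_smul_top p x).trans hle
      have hlt : p < q := lt_of_le_of_ne (le_sup_left.trans hle') (by
        rintro rfl
        exact hxp (hle' (Ideal.mem_sup_right (Ideal.mem_span_singleton_self x))))
      refine ih q hlt hq ?_
      have h1 := Ideal.height_add_one_le_of_lt_of_isPrime hlt
      push_cast
      exact lt_of_lt_of_le ((ENat.add_lt_add_iff_right ENat.one_ne_top).2 hi) h1

/-- `Ext^i(M, R)` vanishes for `i` less than the codimension of the support of `M`. -/
theorem subsingleton_ext_of_forall_height {M : Type u} [AddCommGroup M] [Module R M]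
    [Module.Finite R M] {i : ℕ}
    (h : ∀ p : Ideal R, p.IsPrime → Module.annihilator R M ≤ p → i < p.height) :
    Subsingleton (ExtM R M R i) :=
  subsingleton_ext_of_forall_prime _ fun p hp hle ↦
    subsingleton_ext_quotient_prime p hp (h p hp hle)

end Gorenstein

/-! ### Power torsion and injective modules -/

section Torsion

variable {R : Type u} [CommRing R] (J : Ideal R)

/-- The submodule of elements of `M` killed by some power of `J`. -/
def powerTorsion (M : Type u) [AddCommGroup M] [Module R M] : Submodule R M where
  carrier := {m | ∃ t : ℕ, ∀ a ∈ J ^ t, a • m = 0}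
  zero_mem' := ⟨0, fun a _ ↦ smul_zero a⟩
  add_mem' := by
    rintro x y ⟨s, hs⟩ ⟨t, ht⟩
    refine ⟨s + t, fun a ha ↦ ?_⟩
    rw [smul_add, hs a (Ideal.pow_le_pow_right (Nat.le_add_right _ _) ha),
      ht a (Ideal.pow_le_pow_right (Nat.le_add_left _ _) ha), add_zero]
  smul_mem' := by
    rintro r x ⟨s, hs⟩
    exact ⟨s, fun a ha ↦ by rw [smul_comm, hs a ha, smul_zero]⟩

variable {J} {M N : Type u} [AddCommGroup M] [Module R M] [AddCommGroup N] [Module R N]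

lemma powerTorsion_antitone {I : Ideal R} (h : J ≤ I) : powerTorsion I M ≤ powerTorsion J M := by
  rintro m ⟨t, ht⟩
  exact ⟨t, fun a ha ↦ ht a (Ideal.pow_right_mono h t ha)⟩

lemma map_mem_powerTorsion (f : M →ₗ[R] N) {m : M} (hm : m ∈ powerTorsion J M) :
    f m ∈ powerTorsion J N := by
  obtain ⟨t, ht⟩ := hm
  exact ⟨t, fun a ha ↦ by rw [← map_smul, ht a ha, map_zero]⟩

lemma mem_powerTorsion_of_injective {f : M →ₗ[R] N} (hf : Function.Injective f) {m : M}
    (hm : f m ∈ powerTorsion J N) : m ∈ powerTorsion J M := by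
  obtain ⟨t, ht⟩ := hm
  exact ⟨t, fun a ha ↦ hf (by rw [map_smul, ht a ha, map_zero])⟩

variable (J M) in
/-- Every element of `M` is killed by some power of `J`. -/
def IsPowerTorsion : Prop := ∀ m : M, m ∈ powerTorsion J M

variable (J M) in
/-- No nonzero element of `M` is killed by `J`. -/
def IsTorsionFreeFor : Prop := ∀ m : M, (∀ a ∈ J, a • m = 0) → m = 0

lemma IsPowerTorsion.mono {I : Ideal R} (h : J ≤ I) (hM : IsPowerTorsion I M) :
    IsPowerTorsion J M :=
  fun m ↦ powerTorsion_antitone h (hM m)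

lemma isPowerTorsion_quotient_pow (t : ℕ) : IsPowerTorsion J (R ⧸ J ^ t) := by
  intro m
  refine ⟨t, fun a ha ↦ ?_⟩
  obtain ⟨m, rfl⟩ := Ideal.Quotient.mk_surjective m
  rw [← Ideal.Quotient.mk_eq_mk, ← Submodule.Quotient.mk_smul, Submodule.Quotient.mk_eq_zero]
  exact (J ^ t).mul_mem_right m ha

lemma isPowerTorsion_powerTorsion : IsPowerTorsion J (powerTorsion J M) :=
  fun m ↦ mem_powerTorsion_of_injective (Submodule.injective_subtype _) m.2

lemma IsPowerTorsion.of_surjective (hM : IsPowerTorsion J M) {f : M →ₗ[R] N}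
    (hf : Function.Surjective f) : IsPowerTorsion J N := fun n ↦ by
  obtain ⟨m, rfl⟩ := hf n
  exact map_mem_powerTorsion f (hM m)

lemma IsTorsionFreeFor.eq_zero (hM : IsTorsionFreeFor J M) {m : M} (hm : m ∈ powerTorsion J M) :
    m = 0 := by
  obtain ⟨t, ht⟩ := hm
  induction t generalizing m with
  | zero => simpa using ht 1 (by simp)
  | succ t ih =>
    refine hM m fun a ha ↦ ih fun b hb ↦ ?_
    rw [smul_smul]
    exact ht _ (by rw [pow_succ]; exact Ideal.mul_mem_mul hb ha)

lemma IsTorsionFreeFor.linearMap_eq_zero (hN : IsTorsionFreeFor J N) (hM : IsPowerTorsion J M)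
    (f : M →ₗ[R] N) : f = 0 :=
  LinearMap.ext fun m ↦ hN.eq_zero (map_mem_powerTorsion f (hM m))

/-- A finitely generated module of `J`-power torsion elements is killed by a power of `J`. -/
lemma exists_pow_forall_smul_eq_zero [Module.Finite R M] (g : M →ₗ[R] N)
    (hg : ∀ m, g m ∈ powerTorsion J N) : ∃ t : ℕ, ∀ a ∈ J ^ t, ∀ m, a • g m = 0 := by
  obtain ⟨S, hS⟩ := Module.Finite.fg_top (R := R) (M := M)
  choose t ht using hg
  refine ⟨S.sup t, fun a ha m ↦ ?_⟩
  have hm : m ∈ Submodule.span R (S : Set M) := hS ▸ Submodule.mem_top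
  induction hm using Submodule.span_induction with
  | mem x hx => exact ht x a (Ideal.pow_le_pow_right (Finset.le_sup hx) ha)
  | zero => rw [map_zero, smul_zero]
  | add x y _ _ hx hy => rw [map_add, smul_add, hx, hy, add_zero]
  | smul r x _ hx => rw [map_smul, smul_comm, hx, smul_zero]

lemma subsingleton_ext_of_injective [Module.Injective R N] (i : ℕ) :
    Subsingleton (ExtM R M N (i + 1)) := by
  have : Injective (ModuleCat.of R N) := Module.injective_object_of_injective_module R N
  exact subsingleton_of_forall_eq 0 fun e ↦ Abelian.Ext.eq_zero_of_injective e

/-- Torsion-free injective modules are right orthogonal to modules of power torsion. -/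
lemma subsingleton_ext_of_isPowerTorsion [Module.Injective R N] (hN : IsTorsionFreeFor J N)
    (hM : IsPowerTorsion J M) (i : ℕ) : Subsingleton (ExtM R M N i) := by
  cases i with
  | zero =>
    exact subsingleton_ext_zero_iff.2
      (subsingleton_of_forall_eq 0 fun f ↦ hN.linearMap_eq_zero hM f)
  | succ i => exact subsingleton_ext_of_injective i

lemma exists_injective_embedding (M : Type u) [AddCommGroup M] [Module R M] :
    ∃ (E : Type u) (_ : AddCommGroup E) (_ : Module R E) (f : M →ₗ[R] E),
      Module.Injective R E ∧ Function.Injective f := by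
  let E : ModuleCat.{u} R := Injective.under (ModuleCat.of R M)
  refine ⟨E, inferInstance, inferInstance,
    (Injective.ι (ModuleCat.of R M)).hom, ?_, ?_⟩
  · have hE : Injective E := inferInstanceAs (Injective (Injective.under (ModuleCat.of R M)))
    exact Module.injective_module_of_injective_object (inj := hE) ..
  · exact (ModuleCat.mono_iff_injective _).1 inferInstance

variable [IsNoetherianRing R]

variable (J M) in
lemma isTorsionFreeFor_quotient_powerTorsion : IsTorsionFreeFor J (M ⧸ powerTorsion J M) := by
  intro m hm
  obtain ⟨m, rfl⟩ := Submodule.mkQ_surjective _ m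
  obtain ⟨t, ht⟩ := exists_pow_forall_smul_eq_zero (J := J)
    ((LinearMap.toSpanSingleton R M m) ∘ₗ J.subtype) (fun a ↦ by
      have := hm a a.2
      rwa [← map_smul, Submodule.mkQ_apply, Submodule.Quotient.mk_eq_zero] at this)
  rw [Submodule.mkQ_apply, Submodule.Quotient.mk_eq_zero]
  refine ⟨t + 1, fun a ha ↦ ?_⟩
  rw [pow_succ] at ha
  induction ha using Submodule.mul_induction_on' with
  | mem_mul_mem b hb c hc =>
    rw [mul_smul]
    exact ht b hb ⟨c, hc⟩
  | add x _ y _ hx hy => rw [add_smul, hx, hy, add_zero]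

/-- The power torsion of an injective module over a Noetherian ring is injective: this is Baer's
criterion together with the Artin–Rees lemma. -/
lemma injective_powerTorsion [hM : Module.Injective R M] :
    Module.Injective R (powerTorsion J M) := by
  refine Module.Baer.injective fun K g ↦ ?_
  obtain ⟨t, ht⟩ := exists_pow_forall_smul_eq_zero (J := J) g fun m ↦
    isPowerTorsion_powerTorsion (g m)
  obtain ⟨k, hk⟩ := Ideal.exists_pow_inf_eq_pow_smul J K
  let f : K →ₗ[R] R ⧸ J ^ (t + k) := (J ^ (t + k)).mkQ ∘ₗ K.subtype
  have hker : LinearMap.ker f ≤ LinearMap.ker g := by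
    intro x hx
    have hx1 : (x : R) ∈ J ^ (t + k) := by
      simpa [f, Ideal.Quotient.eq_zero_iff_mem] using hx
    have hx2 : (x : R) ∈ J ^ t • K := by
      have : (x : R) ∈ J ^ (t + k) • (⊤ : Submodule R R) ⊓ K := ⟨by simpa using hx1, x.2⟩
      rw [hk (t + k) (Nat.le_add_left _ _), Nat.add_sub_cancel] at this
      exact Submodule.smul_mono le_rfl inf_le_right this
    have key : ∀ y (hy : y ∈ J ^ t • K) (hyK : y ∈ K), g ⟨y, hyK⟩ = 0 := by
      intro y hy
      induction hy using Submodule.smul_induction_on' with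
      | smul a ha b hb =>
        intro hyK
        rw [← ht a ha ⟨b, hb⟩, ← map_smul]
        rfl
      | add x hx y hy ihx ihy =>
        intro hyK
        have := (congrArg₂ (· + ·) (ihx (Submodule.smul_le_right hx))
          (ihy (Submodule.smul_le_right hy)))
        rw [← map_add, add_zero] at this
        exact this
    exact key x hx2 x.2
  obtain ⟨h, hh⟩ := hM.out ((LinearMap.ker f).liftQ f le_rfl)
    (LinearMap.ker_eq_bot.1 (Submodule.ker_liftQ_eq_bot _ _ _ le_rfl))
    ((powerTorsion J M).subtype ∘ₗ (LinearMap.ker f).liftQ g hker)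
  refine ⟨LinearMap.codRestrict _ (h ∘ₗ (J ^ (t + k)).mkQ)
    fun c ↦ map_mem_powerTorsion h (isPowerTorsion_quotient_pow _ _), fun x hx ↦ ?_⟩
  exact Subtype.ext (hh (Submodule.Quotient.mk ⟨x, hx⟩))

lemma injective_quotient_powerTorsion [hM : Module.Injective R M] :
    Module.Injective R (M ⧸ powerTorsion J M) := by
  have := injective_powerTorsion (J := J) (M := M)
  obtain ⟨r, hr⟩ := this.out (powerTorsion J M).subtype (Submodule.injective_subtype _)
    LinearMap.id
  -- the complement of the power torsion given by the retraction `r`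
  let s : M ⧸ powerTorsion J M →ₗ[R] M := (powerTorsion J M).liftQ
    (LinearMap.id - (powerTorsion J M).subtype ∘ₗ r) fun x hx ↦ by
      have := congrArg Subtype.val (hr ⟨x, hx⟩)
      simp only [LinearMap.mem_ker, LinearMap.sub_apply, LinearMap.id_apply, LinearMap.comp_apply]
      exact sub_eq_zero.2 this.symm
  have hs : ∀ q, (powerTorsion J M).mkQ (s q) = q := by
    intro q
    obtain ⟨q, rfl⟩ := Submodule.mkQ_surjective _ q
    change (powerTorsion J M).mkQ (q - r q) = _
    rw [map_sub, sub_eq_self, Submodule.mkQ_apply, Submodule.Quotient.mk_eq_zero]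
    exact (r q).2
  refine ⟨fun X Y _ _ _ _ f hf g ↦ ?_⟩
  obtain ⟨h, hh⟩ := hM.out f hf (s ∘ₗ g)
  exact ⟨(powerTorsion J M).mkQ ∘ₗ h, fun x ↦ by
    rw [LinearMap.comp_apply, hh, LinearMap.comp_apply, hs]⟩

/-- A `J`-torsion-free module embeds into a `J`-torsion-free injective module. -/
lemma exists_torsionFree_injective_embedding (hM : IsTorsionFreeFor J M) :
    ∃ (Q : Type u) (_ : AddCommGroup Q) (_ : Module R Q) (f : M →ₗ[R] Q),
      Module.Injective R Q ∧ IsTorsionFreeFor J Q ∧ Function.Injective f := by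
  obtain ⟨E, _, _, f, hE, hf⟩ := exists_injective_embedding (R := R) M
  refine ⟨E ⧸ powerTorsion J E, inferInstance, inferInstance, (powerTorsion J E).mkQ ∘ₗ f,
    injective_quotient_powerTorsion, isTorsionFreeFor_quotient_powerTorsion J E, ?_⟩
  rw [injective_iff_map_eq_zero]
  intro m hm
  rw [LinearMap.comp_apply, Submodule.mkQ_apply, Submodule.Quotient.mk_eq_zero] at hm
  exact hM.eq_zero (mem_powerTorsion_of_injective hf hm)

end Torsion

/-! ### Resolution by torsion-free injective modules -/

section Resolution

variable {R : Type u} [CommRing R] {J : Ideal R}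

/-- Yoneda product with `η ∈ Ext^c(N, R)` identifies `Ext^i(M, N)` with `Ext^{i+c}(M, R)`, for all
modules `M` of `J`-power torsion. -/
def IsTorsionDualizing (J : Ideal R) {N : Type u} [AddCommGroup N] [Module R N] {c : ℕ}
    (η : ExtM R N R c) : Prop :=
  ∀ (M : Type u) [AddCommGroup M] [Module R M], IsPowerTorsion J M → ∀ (i n : ℕ) (h : i + c = n),
    Function.Bijective (fun e : ExtM R M N i ↦ (e.comp η h : ExtM R M R n))

lemma IsTorsionDualizing.mono {I : Ideal R} (h : J ≤ I) {N : Type u} [AddCommGroup N]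
    [Module R N] {c : ℕ} {η : ExtM R N R c} (hη : IsTorsionDualizing J η) :
    IsTorsionDualizing I η :=
  fun M _ _ hM ↦ hη M (hM.mono h)

/-- Yoneda product with the class of a homomorphism is pullback along it. -/
lemma homEquiv_comp {M N : Type u} [AddCommGroup M] [Module R M] [AddCommGroup N] [Module R N]
    {c : ℕ} (η : ExtM R N R c) (f : M →ₗ[R] N) :
    (homEquiv M N f).comp η (zero_add c) = pre f R c η := by
  rw [homEquiv_apply, pre_apply]

lemma IsTorsionDualizing.pre_bijective {N : Type u} [AddCommGroup N]
    [Module R N] {c : ℕ} {η : ExtM R N R c} (hη : IsTorsionDualizing J η)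
    {M : Type u} [AddCommGroup M] [Module R M] (hM : IsPowerTorsion J M) :
    Function.Bijective (fun f : M →ₗ[R] N ↦ pre f R c η) := by
  simp_rw [← homEquiv_comp]
  exact (hη M hM 0 c (zero_add c)).comp (homEquiv M N).bijective

/-- Elements of `N` killed by `J` are maps `R/J → N`. -/
lemma isTorsionFreeFor_of_subsingleton {N : Type u} [AddCommGroup N] [Module R N]
    (h : Subsingleton ((R ⧸ J) →ₗ[R] N)) : IsTorsionFreeFor J N := by
  intro m hm
  have := LinearMap.congr_fun (h.elim
    (Submodule.liftQ J (LinearMap.toSpanSingleton R N m) fun a ha ↦ hm a ha) 0)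
    (Submodule.Quotient.mk 1)
  exact (one_smul R m).symm.trans this

lemma isPowerTorsion_quotient : IsPowerTorsion J (R ⧸ J) := fun m ↦ by
  obtain ⟨m, rfl⟩ := Ideal.Quotient.mk_surjective m
  refine ⟨1, fun a ha ↦ ?_⟩
  rw [← Ideal.Quotient.mk_eq_mk, ← Submodule.Quotient.mk_smul, Submodule.Quotient.mk_eq_zero]
  exact J.mul_mem_right m (by simpa using ha)

lemma IsShortExact.δ'_bijective {A B C Y : Type u} [AddCommGroup A] [AddCommGroup B]
    [AddCommGroup C] [AddCommGroup Y] [Module R A] [Module R B] [Module R C] [Module R Y]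
    {f : A →ₗ[R] B} {g : B →ₗ[R] C} (H : IsShortExact f g) (i : ℕ)
    (h₀ : Subsingleton (ExtM R Y B i)) (h₁ : Subsingleton (ExtM R Y B (i + 1))) :
    Function.Bijective (H.δ' Y i) := by
  constructor
  · rw [injective_iff_map_eq_zero]
    intro e he
    obtain ⟨e', rfl⟩ := H.exists_post_of_δ'_eq_zero e he
    rw [h₀.elim e' 0, map_zero]
  · exact fun e ↦ H.exists_δ'_of_post_eq_zero e (h₁.elim _ _)

lemma IsShortExact.δ_bijective {A B C Y : Type u} [AddCommGroup A] [AddCommGroup B]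
    [AddCommGroup C] [AddCommGroup Y] [Module R A] [Module R B] [Module R C] [Module R Y]
    {f : A →ₗ[R] B} {g : B →ₗ[R] C} (H : IsShortExact f g) (i : ℕ)
    (h₀ : Subsingleton (ExtM R B Y i)) (h₁ : Subsingleton (ExtM R B Y (i + 1))) :
    Function.Bijective (H.δ Y i) := by
  constructor
  · rw [injective_iff_map_eq_zero]
    intro e he
    obtain ⟨e', rfl⟩ := H.exists_pre_of_δ_eq_zero e he
    rw [h₀.elim e' 0, map_zero]
  · exact fun e ↦ H.exists_δ_of_pre_eq_zero e (h₁.elim _ _)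

/-- If `Ext^k(R/J, R) = 0` for `k < c`, then `R` can be resolved `c` times by `J`-torsion-free
injective modules, to which modules of `J`-power torsion are blind. The last cosyzygy `N`, together
with the class `η` of the resolution, computes `Ext(M, R)` for all modules `M` of `J`-power
torsion. If moreover torsion-free injective modules are orthogonal to `R`, then `Ext^c(N, R)` is
free on `η`. -/
theorem exists_isTorsionDualizing [IsNoetherianRing R] (c : ℕ)
    (h : ∀ k < c, Subsingleton (ExtM R (R ⧸ J) R k)) :
    ∃ (N : Type u) (_ : AddCommGroup N) (_ : Module R N) (η : ExtM R N R c),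
      IsTorsionDualizing J η ∧
      ((∀ (Q : Type u) [AddCommGroup Q] [Module R Q], Module.Injective R Q →
        IsTorsionFreeFor J Q → ∀ j, Subsingleton (ExtM R Q R j)) →
          Function.Bijective (fun r : R ↦ r • η)) := by
  induction c with
  | zero =>
    refine ⟨R, inferInstance, inferInstance, homEquiv R R LinearMap.id, ?_, fun _ ↦ ?_⟩
    · intro M _ _ _ i n h
      obtain rfl : i = n := h
      convert Function.bijective_id using 2 with e
      exact Abelian.Ext.comp_mk₀_id _
    · simp_rw [← map_smul]
      refine (homEquiv R R).bijective.comp ⟨fun r s hrs ↦ ?_, fun f ↦ ⟨f 1, ?_⟩⟩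
      · simpa using LinearMap.congr_fun hrs 1
      · ext
        simp
  | succ k ih =>
    obtain ⟨N, _, _, η, hη, hη'⟩ := ih fun j hj ↦ h j (hj.trans (Nat.lt_succ_self k))
    have hN : IsTorsionFreeFor J N := isTorsionFreeFor_of_subsingleton <| by
      have := h k (Nat.lt_succ_self k)
      exact (hη.pre_bijective isPowerTorsion_quotient).1.subsingleton
    obtain ⟨Q, _, _, f, hQ, hQJ, hf⟩ := exists_torsionFree_injective_embedding hN
    have H := IsShortExact.of_range_mkQ hf
    refine ⟨Q ⧸ LinearMap.range f, inferInstance, inferInstance, H.δ R k η, ?_, fun hB ↦ ?_⟩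
    · intro M _ _ hM i n hin
      have hb := (hη M hM (i + 1) n (by lia)).comp (H.δ'_bijective (Y := M) i
        (subsingleton_ext_of_isPowerTorsion hQJ hM i)
        (subsingleton_ext_of_isPowerTorsion hQJ hM (i + 1)))
      convert hb using 2 with e
      exact (Abelian.Ext.comp_assoc _ _ _ rfl (add_comm 1 k) (by lia)).symm
    · have hb := (H.δ_bijective (Y := R) k (hB Q hQ hQJ k) (hB Q hQ hQJ (k + 1))).comp (hη' hB)
      convert hb using 2 with r
      exact ((H.δ R k).map_smul r η).symm

end Resolution

/-! ### Local cohomology as power torsion of the last cosyzygy -/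

section LocalCohomology

variable {R : Type u} [CommRing R] {J I : Ideal R} {N : Type u} [AddCommGroup N] [Module R N]
  {c : ℕ} {η : ExtM R N R c}

/-- The map `R/I^t → N` sending `1` to `x`, when `I^t` kills `x`. -/
def levelHom (I : Ideal R) (t : ℕ) (x : N) (hx : ∀ a ∈ I ^ t, a • x = 0) : (R ⧸ I ^ t) →ₗ[R] N :=
  Submodule.liftQ _ (LinearMap.toSpanSingleton R N x) hx

lemma levelHom_comp_quotMap {t s : ℕ} (x : N) (hx : ∀ a ∈ I ^ t, a • x = 0)
    (hx' : ∀ a ∈ J ^ s, a • x = 0) (h : J ^ s ≤ I ^ t) :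
    levelHom I t x hx ∘ₗ (quotMap h).hom = levelHom J s x hx' := by
  apply LinearMap.ext
  intro y
  obtain ⟨y, rfl⟩ := Submodule.mkQ_surjective _ y
  rfl

/-- The class in `H^c_I(R)` of an element `x` of `N` that is killed by `I^t`. -/
def classOf (I : Ideal R) (η : ExtM R N R c) (t : ℕ) (x : N) (hx : ∀ a ∈ I ^ t, a • x = 0) :
    H I c :=
  ofLevel I c t (pre (levelHom I t x hx) R c η)

lemma classOf_eq {t s : ℕ} (h : t ≤ s) (x : N) (hx : ∀ a ∈ I ^ t, a • x = 0)
    (hx' : ∀ a ∈ I ^ s, a • x = 0) : classOf I η t x hx = classOf I η s x hx' := by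
  unfold classOf
  rw [← ofLevel_quotMap I c h]
  congr 1
  rw [← levelHom_comp_quotMap x hx hx' (Ideal.pow_le_pow_right h), pre_comp]
  rfl

lemma incl_classOf (h : J ≤ I) {t : ℕ} (x : N) (hx : ∀ a ∈ I ^ t, a • x = 0)
    (hx' : ∀ a ∈ J ^ t, a • x = 0) : incl h c (classOf I η t x hx) = classOf J η t x hx' := by
  unfold classOf
  rw [incl_ofLevel]
  congr 1
  rw [← levelHom_comp_quotMap x hx hx' (Ideal.pow_right_mono h t), pre_comp]
  rfl

lemma classOf_add {t : ℕ} (x y : N) (hx : ∀ a ∈ I ^ t, a • x = 0) (hy : ∀ a ∈ I ^ t, a • y = 0)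
    (hxy : ∀ a ∈ I ^ t, a • (x + y) = 0) :
    classOf I η t (x + y) hxy = classOf I η t x hx + classOf I η t y hy := by
  unfold classOf
  rw [← map_add, ← pre_add]
  refine congrArg (fun f ↦ ofLevel I c t (pre f R c η)) (LinearMap.ext fun z ↦ ?_)
  obtain ⟨z, rfl⟩ := Submodule.mkQ_surjective _ z
  exact smul_add z x y

lemma classOf_smul {t : ℕ} (r : R) (x : N) (hx : ∀ a ∈ I ^ t, a • x = 0)
    (hrx : ∀ a ∈ I ^ t, a • r • x = 0) :
    classOf I η t (r • x) hrx = r • classOf I η t x hx := by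
  unfold classOf
  rw [← map_smul, ← pre_smul]
  refine congrArg (fun f ↦ ofLevel I c t (pre f R c η)) (LinearMap.ext fun z ↦ ?_)
  obtain ⟨z, rfl⟩ := Submodule.mkQ_surjective _ z
  exact smul_comm z r x

/-- The map from the `I`-power torsion of `N` to `H^c_I(R)`, sending `x` to the pullback of `η`
along `R/I^t → N`, `1 ↦ x`. -/
def toH (I : Ideal R) (η : ExtM R N R c) : powerTorsion I N →ₗ[R] H I c where
  toFun x := classOf I η x.2.choose x x.2.choose_spec
  map_add' x y := by
    have hk : ∀ {s t : ℕ} {z : N}, s ≤ t → (∀ a ∈ I ^ s, a • z = 0) → ∀ a ∈ I ^ t, a • z = 0 :=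
      fun h hz a ha ↦ hz a (Ideal.pow_le_pow_right h ha)
    let T := x.2.choose + y.2.choose + (x + y).2.choose
    have h1 : x.2.choose ≤ T := by lia
    have h2 : y.2.choose ≤ T := by lia
    have h3 : (x + y).2.choose ≤ T := by lia
    rw [classOf_eq h1 _ _ (hk h1 x.2.choose_spec), classOf_eq h2 _ _ (hk h2 y.2.choose_spec),
      classOf_eq h3 _ _ (hk h3 (x + y).2.choose_spec)]
    exact classOf_add ..
  map_smul' r x := by
    have hk : ∀ {s t : ℕ} {z : N}, s ≤ t → (∀ a ∈ I ^ s, a • z = 0) → ∀ a ∈ I ^ t, a • z = 0 :=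
      fun h hz a ha ↦ hz a (Ideal.pow_le_pow_right h ha)
    let T := x.2.choose + (r • x).2.choose
    have h1 : x.2.choose ≤ T := by lia
    have h3 : (r • x).2.choose ≤ T := by lia
    rw [classOf_eq h1 _ _ (hk h1 x.2.choose_spec),
      classOf_eq h3 _ _ (hk h3 (r • x).2.choose_spec)]
    exact classOf_smul ..

lemma toH_eq (x : powerTorsion I N) (t : ℕ) (hx : ∀ a ∈ I ^ t, a • (x : N) = 0) :
    toH I η x = classOf I η t x hx := by
  have h1 : x.2.choose ≤ x.2.choose + t := Nat.le_add_right _ _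
  have h2 : t ≤ x.2.choose + t := Nat.le_add_left _ _
  have hx' : ∀ a ∈ I ^ (x.2.choose + t), a • (x : N) = 0 :=
    fun a ha ↦ hx a (Ideal.pow_le_pow_right h2 ha)
  exact (classOf_eq h1 _ _ hx').trans (classOf_eq h2 _ _ hx').symm

/-- As `Hom(R/I^t, N) = Ext^c(R/I^t, R)`, the elements of `N` killed by `I^t` are the elements of
`H^c_I(R)` coming from level `t`. -/
lemma toH_bijective (hη : IsTorsionDualizing I η) : Function.Bijective (toH I η) := by
  constructor
  · rw [injective_iff_map_eq_zero]
    intro x hx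
    obtain ⟨t, ht⟩ := x.2
    rw [toH_eq x t ht] at hx
    obtain ⟨s, hts, hs⟩ := ofLevel_eq_zero _ _ _ _ hx
    have h1 : pre (levelHom I s (x : N) fun a ha ↦ ht a (Ideal.pow_le_pow_right hts ha)) R c η
        = 0 := by
      rw [← levelHom_comp_quotMap (x : N) ht _ (Ideal.pow_le_pow_right hts), pre_comp]
      exact hs
    have h2 := (hη.pre_bijective (isPowerTorsion_quotient_pow s)).1
      (h1.trans (pre_zero (A := R ⧸ I ^ s) c η).symm)
    have h3 := LinearMap.congr_fun h2 (Submodule.Quotient.mk 1)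
    exact Subtype.ext ((one_smul R (x : N)).symm.trans h3)
  · intro y
    obtain ⟨t, e, rfl⟩ := exists_ofLevel_eq I c y
    obtain ⟨f, hf⟩ := (hη.pre_bijective (isPowerTorsion_quotient_pow t)).2 e
    have hx : ∀ a ∈ I ^ t, a • f (Submodule.Quotient.mk 1) = 0 := fun a ha ↦ by
      rw [← map_smul, ← Submodule.Quotient.mk_smul,
        (Submodule.Quotient.mk_eq_zero _).2 (by simpa using ha), map_zero]
    refine ⟨⟨f (Submodule.Quotient.mk 1), t, hx⟩, ?_⟩
    rw [toH_eq _ t hx, ← hf]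
    unfold classOf
    refine congrArg (fun f ↦ ofLevel I c t (pre f R c η)) (LinearMap.ext fun z ↦ ?_)
    obtain ⟨z, rfl⟩ := Submodule.mkQ_surjective _ z
    change z • f (Submodule.Quotient.mk 1) = _
    rw [← map_smul, ← Submodule.Quotient.mk_smul, smul_eq_mul, mul_one]
    rfl

namespace IsTorsionDualizing

/-- The embedding of `H^c_I(R)` into `N`, with image the `I`-power torsion. -/
def ofH (hη : IsTorsionDualizing I η) : H I c →ₗ[R] N :=
  (powerTorsion I N).subtype ∘ₗ (LinearEquiv.ofBijective _ (toH_bijective hη)).symm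

lemma ofH_toH (hη : IsTorsionDualizing I η) (x : powerTorsion I N) : hη.ofH (toH I η x) = x := by
  have := (LinearEquiv.ofBijective _ (toH_bijective hη)).symm_apply_apply x
  exact congrArg Subtype.val this

lemma ofH_injective (hη : IsTorsionDualizing I η) : Function.Injective hη.ofH :=
  (Submodule.injective_subtype _).comp (LinearEquiv.injective _)

lemma ofH_mem (hη : IsTorsionDualizing I η) (x : H I c) : hη.ofH x ∈ powerTorsion I N :=
  Subtype.prop _

lemma exists_ofH_eq (hη : IsTorsionDualizing I η) {x : N} (hx : x ∈ powerTorsion I N) :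
    ∃ y, hη.ofH y = x :=
  ⟨toH I η ⟨x, hx⟩, hη.ofH_toH _⟩

lemma isPowerTorsion_H (hη : IsTorsionDualizing I η) : IsPowerTorsion I (H I c) :=
  fun x ↦ mem_powerTorsion_of_injective hη.ofH_injective (hη.ofH_mem x)

lemma ofH_incl (h : J ≤ I) (hJ : IsTorsionDualizing J η) (hI : IsTorsionDualizing I η)
    (x : H I c) : hJ.ofH (incl h c x) = hI.ofH x := by
  obtain ⟨x, rfl⟩ := (toH_bijective hI).2 x
  obtain ⟨t, ht⟩ := x.2
  have ht' : ∀ a ∈ J ^ t, a • (x : N) = 0 := fun a ha ↦ ht a (Ideal.pow_right_mono h t ha)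
  rw [hI.ofH_toH, toH_eq x t ht, incl_classOf h _ ht ht',
    ← toH_eq (η := η) ⟨(x : N), t, ht'⟩ t ht', hJ.ofH_toH]

/-- Both local cohomology modules embed into the same module `N`. -/
lemma incl_injective (h : J ≤ I) (hJ : IsTorsionDualizing J η) :
    Function.Injective (incl h c) := by
  have hI := hJ.mono h
  intro x y hxy
  exact hI.ofH_injective (by rw [← ofH_incl h hJ hI, hxy, ofH_incl h hJ hI])

lemma exists_incl_eq (h : J ≤ I) (hJ : IsTorsionDualizing J η) {x : H J c}
    (hx : x ∈ powerTorsion I (H J c)) : ∃ y, incl h c y = x := by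
  have hI := hJ.mono h
  obtain ⟨y, hy⟩ := hI.exists_ofH_eq (map_mem_powerTorsion hJ.ofH hx)
  exact ⟨y, hJ.ofH_injective (by rw [ofH_incl h hJ hI, hy])⟩

/-- Every map from a module of `I`-power torsion to `N` factors through `H^c_I(R)`. -/
lemma exists_ofH_comp_eq (hη : IsTorsionDualizing I η) {M : Type u} [AddCommGroup M] [Module R M]
    (hM : IsPowerTorsion I M) (f : M →ₗ[R] N) : ∃ g : M →ₗ[R] H I c, hη.ofH ∘ₗ g = f := by
  refine ⟨toH I η ∘ₗ LinearMap.codRestrict _ f fun m ↦ map_mem_powerTorsion f (hM m), ?_⟩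
  apply LinearMap.ext
  intro m
  exact hη.ofH_toH _

lemma ofH_comp_bijective (hη : IsTorsionDualizing I η) :
    Function.Bijective fun f : Module.End R (H I c) ↦ hη.ofH ∘ₗ f := by
  refine ⟨fun f g hfg ↦ ?_, fun f ↦ hη.exists_ofH_comp_eq hη.isPowerTorsion_H f⟩
  exact LinearMap.ext fun x ↦ hη.ofH_injective (LinearMap.congr_fun hfg x)

/-- The map `End(H^c_I(R)) → Ext^c(H^c_I(R), R)` given by pulling back the class of the identity. -/
def endToExt (hη : IsTorsionDualizing I η) :
    Module.End R (H I c) →ₗ[R] ExtM R (H I c) R c where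
  toFun f := pre f R c (pre hη.ofH R c η)
  map_add' _ _ := pre_add ..
  map_smul' _ _ := pre_smul ..

lemma endToExt_apply (hη : IsTorsionDualizing I η) (f : Module.End R (H I c)) :
    hη.endToExt f = pre f R c (pre hη.ofH R c η) := rfl

lemma endToExt_apply' (hη : IsTorsionDualizing I η) (f : Module.End R (H I c)) :
    hη.endToExt f = pre (hη.ofH ∘ₗ f) R c η := by
  rw [endToExt_apply, pre_comp]

lemma endToExt_bijective (hη : IsTorsionDualizing I η) : Function.Bijective hη.endToExt := by
  have : ⇑hη.endToExt = (fun f ↦ pre f R c η) ∘ fun f ↦ hη.ofH ∘ₗ f :=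
    funext fun f ↦ hη.endToExt_apply' f
  rw [this]
  exact (hη.pre_bijective hη.isPowerTorsion_H).comp hη.ofH_comp_bijective

end IsTorsionDualizing

end LocalCohomology

/-! ### Restriction of endomorphisms -/

section Restriction

variable {R : Type u} [CommRing R]

/-- If `A` is stable under all endomorphisms of `B`, endomorphisms of `B` restrict to `A`. -/
lemma exists_restriction {A B : Type u} [AddCommGroup A] [Module R A] [AddCommGroup B] [Module R B]
    (ι : A →ₗ[R] B) (hι : Function.Injective ι)
    (h : ∀ (f : Module.End R B) (a : A), ∃ a', ι a' = f (ι a)) :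
    ∃ φ : Module.End R B →ₐ[R] Module.End R A, ∀ f, ι ∘ₗ φ f = f ∘ₗ ι := by
  let r (f : Module.End R B) : Module.End R A :=
    (LinearEquiv.ofInjective ι hι).symm ∘ₗ LinearMap.codRestrict (LinearMap.range ι) (f ∘ₗ ι) (h f)
  have hr : ∀ f a, ι (r f a) = f (ι a) := fun f a ↦ by
    have := (LinearEquiv.ofInjective ι hι).apply_symm_apply
      (LinearMap.codRestrict (LinearMap.range ι) (f ∘ₗ ι) (h f) a)
    exact congrArg Subtype.val this
  let φ : Module.End R B →ₗ[R] Module.End R A :=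
    { toFun := r
      map_add' := fun f g ↦ LinearMap.ext fun a ↦ hι (by simp [hr])
      map_smul' := fun x f ↦ LinearMap.ext fun a ↦ hι (by simp [hr]) }
  refine ⟨AlgHom.ofLinearMap φ (LinearMap.ext fun a ↦ hι ?_)
    (fun f g ↦ LinearMap.ext fun a ↦ hι ?_), fun f ↦ LinearMap.ext fun a ↦ hr f a⟩
  · exact hr 1 a
  · exact (hr _ a).trans ((congrArg f (hr g a).symm).trans (hr f _).symm)

variable {J I : Ideal R} {N : Type u} [AddCommGroup N] [Module R N] {c : ℕ} {η : ExtM R N R c}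

namespace IsTorsionDualizing

lemma exists_isRestriction (hη : IsTorsionDualizing J η) (h : J ≤ I) :
    ∃ φ : Module.End R (H J c) →ₐ[R] Module.End R (H I c), IsRestriction h c φ :=
  exists_restriction (incl h c) (hη.incl_injective h) fun f a ↦ hη.exists_incl_eq h
    (map_mem_powerTorsion f (map_mem_powerTorsion _ ((hη.mono h).isPowerTorsion_H a)))

lemma isRestriction_unique (hη : IsTorsionDualizing J η) (h : J ≤ I)
    {φ ψ : Module.End R (H J c) →ₐ[R] Module.End R (H I c)} (hφ : IsRestriction h c φ)
    (hψ : IsRestriction h c ψ) : ψ = φ :=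
  AlgHom.ext fun f ↦ LinearMap.ext fun a ↦ hη.incl_injective h
    (LinearMap.congr_fun ((hψ f).trans (hφ f).symm) a)

/-- The natural isomorphism `End(H^c_I(R)) ≃ Ext^c(H^c_I(R), R)`. -/
def endEquivExt (hη : IsTorsionDualizing I η) : Module.End R (H I c) ≃ₗ[R] ExtR (H I c) c :=
  (LinearEquiv.ofBijective hη.endToExt hη.endToExt_bijective).trans
    (extEquiv (H I c) (ModuleCat.of R R) c).symm

lemma extEquiv_endEquivExt (hη : IsTorsionDualizing I η) (f : Module.End R (H I c)) :
    extEquiv (H I c) (ModuleCat.of R R) c (hη.endEquivExt f) = hη.endToExt f :=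
  LinearEquiv.apply_symm_apply _ _

lemma extEquiv_extMap {M M' : ModuleCat.{u} R} (f : M →ₗ[R] M') (n : ℕ) (e : ExtR M' n) :
    extEquiv M (ModuleCat.of R R) n (extMap f n e) =
      pre f R n (extEquiv M' (ModuleCat.of R R) n e) :=
  extEquiv_naturality (ModuleCat.ofHom f) (ModuleCat.of R R) n e

lemma isInducedByExt (hη : IsTorsionDualizing J η) (h : J ≤ I)
    {φ : Module.End R (H J c) →ₐ[R] Module.End R (H I c)} (hφ : IsRestriction h c φ) :
    IsInducedByExt h c φ := by
  have hI := hη.mono h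
  have key : ∀ {K : Ideal R} (hK : IsTorsionDualizing K η) (f : Module.End R (H K c)),
      hK.endEquivExt f = extMap f c (hK.endEquivExt LinearMap.id) := fun hK f ↦ by
    refine (extEquiv _ _ _).injective ?_
    rw [extEquiv_extMap, extEquiv_endEquivExt, extEquiv_endEquivExt, hK.endToExt_apply,
      hK.endToExt_apply, pre_id]
  refine ⟨hη.endEquivExt, hI.endEquivExt, key hη, key hI, fun f ↦ ?_⟩
  refine (extEquiv _ _ _).injective ?_
  rw [extEquiv_extMap, extEquiv_endEquivExt, extEquiv_endEquivExt, hI.endToExt_apply',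
    hη.endToExt_apply', ← pre_comp]
  congr 2
  have h1 : hI.ofH = hη.ofH ∘ₗ incl h c := LinearMap.ext fun x ↦ (ofH_incl h hη hI x).symm
  rw [h1, LinearMap.comp_assoc, hφ f, LinearMap.comp_assoc]

end IsTorsionDualizing

end Restriction

/-! ### Modules supported in high codimension -/

section Codimension

variable {R : Type u} [CommRing R] (J : Ideal R) (k : ℕ)

/-- The submodule of elements of `M` of `J`-power torsion whose support has codimension at least
`k`. -/
def codimTorsion (M : Type u) [AddCommGroup M] [Module R M] : Submodule R M where
  carrier := {m | m ∈ powerTorsion J M ∧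
    ∀ p : Ideal R, p.IsPrime → (∀ a : R, a • m = 0 → a ∈ p) → k ≤ p.height}
  zero_mem' := ⟨zero_mem _, fun p hp h ↦
    absurd (h 1 (smul_zero _)) ((Ideal.ne_top_iff_one p).1 hp.ne_top)⟩
  add_mem' := by
    rintro x y ⟨hx, hx'⟩ ⟨hy, hy'⟩
    refine ⟨add_mem hx hy, fun p hp h ↦ ?_⟩
    by_contra hk
    obtain ⟨a, ha, hap⟩ : ∃ a : R, a • x = 0 ∧ a ∉ p := by
      by_contra! hne
      exact hk (hx' p hp hne)
    obtain ⟨b, hb, hbp⟩ : ∃ b : R, b • y = 0 ∧ b ∉ p := by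
      by_contra! hne
      exact hk (hy' p hp hne)
    refine (hp.mem_or_mem (h (a * b) ?_)).elim hap hbp
    rw [smul_add, mul_smul a b y, hb, smul_zero, mul_comm, mul_smul, ha, smul_zero, add_zero]
  smul_mem' := by
    rintro r x ⟨hx, hx'⟩
    refine ⟨Submodule.smul_mem _ r hx, fun p hp h ↦ hx' p hp fun a ha ↦ h a ?_⟩
    rw [smul_comm, ha, smul_zero]

variable {J k} {M M' : Type u} [AddCommGroup M] [Module R M] [AddCommGroup M'] [Module R M']

lemma map_mem_codimTorsion (f : M →ₗ[R] M') {m : M} (hm : m ∈ codimTorsion J k M) :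
    f m ∈ codimTorsion J k M' :=
  ⟨map_mem_powerTorsion f hm.1, fun p hp h ↦ hm.2 p hp fun a ha ↦ h a (by
    rw [← map_smul, ha, map_zero])⟩

variable [IsLocalGorenstein R] {N : Type u} [AddCommGroup N] [Module R N] {c : ℕ} {η : ExtM R N R c}

namespace IsTorsionDualizing

/-- The cyclic submodule generated by an element supported in codimension at least `k` has vanishing
`Ext^i(-, N) = Ext^{i+c}(-, R)` for `i + c < k`. -/
lemma subsingleton_ext_span (hη : IsTorsionDualizing J η) {i : ℕ} (hi : i + c < k) {m : M}
    (hm : m ∈ codimTorsion J k M) :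
    Subsingleton (ExtM R (R ⧸ LinearMap.ker (LinearMap.toSpanSingleton R M m)) N i) := by
  have ht : IsPowerTorsion J (R ⧸ LinearMap.ker (LinearMap.toSpanSingleton R M m)) := by
    obtain ⟨t, ht⟩ := hm.1
    intro x
    obtain ⟨x, rfl⟩ := Submodule.mkQ_surjective _ x
    refine ⟨t, fun a ha ↦ ?_⟩
    rw [← map_smul, Submodule.mkQ_apply, Submodule.Quotient.mk_eq_zero, smul_eq_mul, mul_comm]
    exact Ideal.mul_mem_left _ x (ht a ha)
  have : Subsingleton (ExtM R (R ⧸ LinearMap.ker (LinearMap.toSpanSingleton R M m)) R (i + c)) :=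
    subsingleton_ext_of_forall_height fun p hp hle ↦ by
      rw [Ideal.annihilator_quotient] at hle
      exact lt_of_lt_of_le (by exact_mod_cast hi) (hm.2 p hp fun a ha ↦ hle ha)
  exact (hη _ ht i (i + c) rfl).1.subsingleton

/-- `N` has no nonzero elements supported in codimension at least `c + 1`. -/
lemma eq_zero_of_mem_codimTorsion (hη : IsTorsionDualizing J η) (hk : c < k) {x : N}
    (hx : x ∈ codimTorsion J k N) : x = 0 := by
  have := subsingleton_ext_zero_iff.1 (hη.subsingleton_ext_span (i := 0) (by lia) hx)
  have := LinearMap.congr_fun (this.elim ((LinearMap.ker _).liftQ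
    (LinearMap.toSpanSingleton R N x) le_rfl) 0) (Submodule.Quotient.mk 1)
  exact (one_smul R x).symm.trans this

lemma linearMap_eq_zero_of_codim (hη : IsTorsionDualizing J η) (hk : c < k)
    (hM : ∀ m : M, m ∈ codimTorsion J k M) (f : M →ₗ[R] N) : f = 0 :=
  LinearMap.ext fun m ↦ hη.eq_zero_of_mem_codimTorsion hk (map_mem_codimTorsion f (hM m))

/-- If `M` is supported in codimension at least `c + 2`, then `Ext^1(M, N) = 0`: the cyclic
submodules of `M` have `Ext^1(-, N) = 0`, and lifts along an injective hull modulo `N` glue, as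
they are unique. -/
lemma subsingleton_ext_one_of_codim (hη : IsTorsionDualizing J η) (hk : c + 1 < k)
    (hM : ∀ m : M, m ∈ codimTorsion J k M) : Subsingleton (ExtM R M N 1) := by
  obtain ⟨E, _, _, j, hE, hj⟩ := exists_injective_embedding (R := R) N
  have S := IsShortExact.of_range_mkQ hj
  set π := (LinearMap.range j).mkQ with hπ
  -- `π` restricts to an isomorphism on the elements supported in codimension `k`
  let ρ : codimTorsion J k E →ₗ[R] codimTorsion J k (E ⧸ LinearMap.range j) :=
    π.restrict fun x hx ↦ map_mem_codimTorsion π hx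
  have hρ : Function.Bijective ρ := by
    constructor
    · rw [injective_iff_map_eq_zero]
      rintro ⟨x, hx⟩ h0
      obtain ⟨y, rfl⟩ := (S.exact x).1 (congrArg Subtype.val h0)
      have hy : y ∈ codimTorsion J k N :=
        ⟨mem_powerTorsion_of_injective hj hx.1, fun p hp h ↦ hx.2 p hp fun a ha ↦
          h a (hj (by rw [map_smul, ha, map_zero]))⟩
      have := hη.eq_zero_of_mem_codimTorsion (by lia) hy
      exact Subtype.ext (by simp [this])
    · rintro ⟨z, hz⟩
      have h1 := hη.subsingleton_ext_span (i := 1) (by lia) hz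
      let g := (LinearMap.ker _).liftQ (LinearMap.toSpanSingleton R _ z) le_rfl
      obtain ⟨e, he⟩ := S.exists_post_of_δ'_eq_zero (homEquiv _ _ g) (h1.elim _ _)
      obtain ⟨l, rfl⟩ := (homEquiv _ _).surjective e
      rw [post_homEquiv] at he
      have hl := LinearMap.congr_fun ((homEquiv _ _).injective he)
      let x := l (Submodule.Quotient.mk 1)
      have hx : π x = z := (hl _).trans (one_smul R z)
      have hax : ∀ a : R, a • z = 0 → a • x = 0 := fun a ha ↦ by
        rw [← map_smul, ← Submodule.Quotient.mk_smul, (Submodule.Quotient.mk_eq_zero _).2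
          (by simpa using ha), map_zero]
      obtain ⟨⟨t, ht⟩, hz2⟩ := hz
      exact ⟨⟨x, ⟨t, fun a ha ↦ hax a (ht a ha)⟩, fun p hp h ↦ hz2 p hp fun a ha ↦ h a (hax a ha)⟩,
        Subtype.ext hx⟩
  refine subsingleton_of_forall_eq 0 fun e ↦ ?_
  obtain ⟨e, rfl⟩ := S.exists_δ'_of_post_eq_zero e
    ((subsingleton_ext_of_injective (M := M) (N := E) 0).elim _ _)
  obtain ⟨g, rfl⟩ := (homEquiv _ _).surjective e
  let l : M →ₗ[R] E := (codimTorsion J k E).subtype ∘ₗ (LinearEquiv.ofBijective ρ hρ).symm ∘ₗ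
    LinearMap.codRestrict _ g fun m ↦ map_mem_codimTorsion g (hM m)
  have hl : π ∘ₗ l = g := LinearMap.ext fun m ↦ congrArg Subtype.val
    ((LinearEquiv.ofBijective ρ hρ).apply_symm_apply ⟨g m, map_mem_codimTorsion g (hM m)⟩)
  rw [← hl, ← post_homEquiv, S.δ'_post]

/-- Maps to `N` extend uniquely along maps with cokernel supported in codimension at least
`c + 2`. -/
lemma comp_bijective_of_codim (hη : IsTorsionDualizing J η) (hk : c + 1 < k) {ι : M →ₗ[R] M'}
    (hι : Function.Injective ι)
    (hC : ∀ y : M' ⧸ LinearMap.range ι, y ∈ codimTorsion J k (M' ⧸ LinearMap.range ι)) :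
    Function.Bijective fun f : M' →ₗ[R] N ↦ f ∘ₗ ι := by
  have S := IsShortExact.of_range_mkQ hι
  constructor
  · intro f g hfg
    have h0 : LinearMap.range ι ≤ LinearMap.ker (f - g) := by
      rintro _ ⟨x, rfl⟩
      exact sub_eq_zero.2 (LinearMap.congr_fun hfg x)
    have := hη.linearMap_eq_zero_of_codim (by lia) hC ((LinearMap.range ι).liftQ (f - g) h0)
    refine sub_eq_zero.1 (LinearMap.ext fun x ↦ ?_)
    exact LinearMap.congr_fun this (Submodule.Quotient.mk x)
  · intro f
    obtain ⟨e, he⟩ := S.exists_pre_of_δ_eq_zero (homEquiv _ _ f)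
      ((hη.subsingleton_ext_one_of_codim hk hC).elim _ _)
    obtain ⟨g, rfl⟩ := (homEquiv _ _).surjective e
    rw [pre_homEquiv] at he
    exact ⟨g, (homEquiv _ _).injective he⟩

/-- The image of `H^c_I(R)` in `H^c_J(R)` determines the endomorphisms of the latter if the cokernel
is supported in codimension at least `c + 2`. -/
lemma restriction_bijective {I : Ideal R} (hη : IsTorsionDualizing J η) (h : J ≤ I)
    (hk : c + 1 < k)
    (hC : ∀ x : H J c, (LinearMap.range (incl h c)).mkQ x ∈ codimTorsion J k _)
    {φ : Module.End R (H J c) →ₐ[R] Module.End R (H I c)} (hφ : IsRestriction h c φ) :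
    Function.Bijective φ := by
  have hb := hη.comp_bijective_of_codim hk (hη.incl_injective h) (fun y ↦ by
    obtain ⟨x, rfl⟩ := Submodule.mkQ_surjective _ y
    exact hC x)
  have hI := hη.mono h
  have h1 : hI.ofH = hη.ofH ∘ₗ incl h c := LinearMap.ext fun x ↦ (ofH_incl h hη hI x).symm
  have h2 : ∀ f, hI.ofH ∘ₗ φ f = (hη.ofH ∘ₗ f) ∘ₗ incl h c := fun f ↦ by
    rw [h1, LinearMap.comp_assoc, hφ f, LinearMap.comp_assoc]
  refine ⟨fun f g hfg ↦ hη.ofH_comp_bijective.1 (hb.1 ?_), fun g ↦ ?_⟩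
  · exact (h2 f).symm.trans ((congrArg (hI.ofH ∘ₗ ·) hfg).trans (h2 g))
  · obtain ⟨l, hl⟩ := hb.2 (hI.ofH ∘ₗ g)
    obtain ⟨f, rfl⟩ := hη.exists_ofH_comp_eq hη.isPowerTorsion_H l
    exact ⟨f, hI.ofH_comp_bijective.1 ((h2 f).trans hl)⟩

end IsTorsionDualizing

end Codimension

/-! ### Support conditions from equality of radicals -/

section Support

variable {R : Type u} [CommRing R] {J I : Ideal R}

lemma pow_mul_pow_le {L K : Ideal R} (h : L * K ≤ J) (n : ℕ) : L ^ n * K ^ n ≤ J ^ n := by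
  rw [← mul_pow]
  exact Ideal.pow_right_mono h n

/-- If `J` and `I` have the same radical at `p`, then some element outside `p` multiplies a power of
`I` into `J`. -/
lemma exists_span_mul_pow_le [IsNoetherianRing R] {p : PrimeSpectrum R}
    (h : SameRadicalAt J I p) : ∃ s ∉ p.asIdeal, ∃ t : ℕ, Ideal.span {s} * I ^ t ≤ J := by
  obtain ⟨t, ht⟩ := Ideal.exists_pow_le_of_le_radical_of_fg
    (Ideal.le_radical.trans h.ge) (Ideal.FG.map (IsNoetherian.noetherian I) _)
  rw [← Ideal.map_pow] at ht
  have h1 : ∀ a ∈ I ^ t, ∃ s ∉ p.asIdeal, s * a ∈ J := fun a ha ↦ by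
    obtain ⟨s, hs, hsa⟩ := (IsLocalization.algebraMap_mem_map_algebraMap_iff p.asIdeal.primeCompl
      (Localization.AtPrime p.asIdeal) J a).1 (ht (Ideal.mem_map_of_mem _ ha))
    exact ⟨s, hs, hsa⟩
  obtain ⟨S, hS⟩ := IsNoetherian.noetherian (I ^ t)
  have h2 : ∀ x : S, ∃ s ∉ p.asIdeal, s * (x : R) ∈ J :=
    fun x ↦ h1 x (hS ▸ Submodule.subset_span x.2)
  choose s hs hsJ using h2
  refine ⟨∏ x, s x, ?_, t, ?_⟩
  · rw [Ideal.IsPrime.prod_mem_iff]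
    simpa using hs
  · rw [← hS, ← Ideal.span, Ideal.span_mul_span', Ideal.span_le]
    rintro _ ⟨_, rfl, x, hx, rfl⟩
    obtain ⟨b, hb⟩ := Finset.dvd_prod_of_mem s (Finset.mem_univ (⟨x, hx⟩ : S))
    change (∏ x, s x) * x ∈ J
    rw [hb, mul_right_comm]
    exact Ideal.mul_mem_right _ _ (hsJ ⟨x, hx⟩)

lemma exists_span_mul_pow_le_of_height_lt [IsNoetherianRing R] {p : Ideal R} (hp : p.IsPrime)
    {c : ℕ} (hc : p.height < (c + 2 : ℕ))
    (h : ringKrullDim (Localization.AtPrime p) ≤ c + 1 → SameRadicalAt J I ⟨p, hp⟩) :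
    ∃ s ∉ p, ∃ t : ℕ, Ideal.span {s} * I ^ t ≤ J := by
  refine exists_span_mul_pow_le (h ?_)
  rw [IsLocalization.AtPrime.ringKrullDim_eq_height p]
  obtain ⟨n, hn⟩ := ENat.ne_top_iff_exists.1 hc.ne_top
  rw [← hn] at hc ⊢
  norm_cast at hc ⊢
  lia

lemma pow_smul_mem_powerTorsion {M : Type u} [AddCommGroup M] [Module R M] {x : M} {k : ℕ}
    (hx : ∀ a ∈ J ^ k, a • x = 0) {L K : Ideal R} (h : L * K ≤ J) {b : R} (hb : b ∈ L ^ k) :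
    b • x ∈ powerTorsion K M :=
  ⟨k, fun a ha ↦ by
    rw [smul_smul, mul_comm]
    exact hx _ (pow_mul_pow_le h k (Ideal.mul_mem_mul hb ha))⟩

lemma powerTorsion_pow_le {M : Type u} [AddCommGroup M] [Module R M] (t : ℕ) :
    powerTorsion (J ^ t) M ≤ powerTorsion J M := by
  rintro x ⟨k, hk⟩
  exact ⟨t * k, fun a ha ↦ hk a (by rwa [← pow_mul])⟩

/-- If `J` and `I` agree up to radical at primes of height at most `c + 1`, then
`M / Γ_I(M)` is supported in codimension at least `c + 2`, for all `M` of `J`-power torsion. -/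
lemma mkQ_mem_codimTorsion [IsNoetherianRing R] {c : ℕ}
    (h : ∀ p ∈ PrimeSpectrum.zeroLocus (J : Set R),
      ringKrullDim (Localization.AtPrime p.asIdeal) ≤ c + 1 → SameRadicalAt J I p)
    {M : Type u} [AddCommGroup M] [Module R M] (hM : IsPowerTorsion J M) {P : Submodule R M}
    (hP : powerTorsion I M ≤ P) (x : M) : P.mkQ x ∈ codimTorsion J (c + 2) (M ⧸ P) := by
  refine ⟨map_mem_powerTorsion _ (hM x), fun p hp hle ↦ ?_⟩
  by_contra! hlt
  obtain ⟨k, hk⟩ := hM x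
  have hJp : J ≤ p := hp.le_of_pow_le (n := k) fun a ha ↦ hle a (by
    rw [← map_smul, hk a ha, map_zero])
  obtain ⟨s, hs, t, hst⟩ := exists_span_mul_pow_le_of_height_lt hp hlt (h ⟨p, hp⟩ hJp)
  refine hs (hp.mem_of_pow_mem k (hle _ ?_))
  rw [← map_smul, Submodule.mkQ_apply, Submodule.Quotient.mk_eq_zero]
  exact hP (powerTorsion_pow_le t (pow_smul_mem_powerTorsion hk hst
    (Ideal.pow_mem_pow (Ideal.mem_span_singleton_self s) k)))

lemma IsTorsionDualizing.powerTorsion_le_range_incl {c : ℕ} {N : Type u} [AddCommGroup N]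
    [Module R N]
    {η : ExtM R N R c} (hη : IsTorsionDualizing J η) (h : J ≤ I) :
    powerTorsion I (H J c) ≤ LinearMap.range (incl h c) :=
  fun _ hx ↦ hη.exists_incl_eq h hx

end Support

/-! ### The restriction homomorphism -/

section RestrictionHom

variable {R : Type u} [CommRing R] [IsLocalGorenstein R] {J I : Ideal R} {c : ℕ}

lemma subsingleton_ext_of_lt_height (hJ : J.height = c) {k : ℕ} (hk : k < c) (t : ℕ) :
    Subsingleton (ExtM R (R ⧸ J ^ t) R k) :=
  subsingleton_ext_of_forall_height fun p hp hle ↦ by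
    rw [Ideal.annihilator_quotient] at hle
    refine lt_of_lt_of_le ?_ (Ideal.height_mono (hp.le_of_pow_le hle))
    rw [hJ]
    exact_mod_cast hk

lemma exists_isTorsionDualizing_of_height (hJ : J.height = c) :
    ∃ (N : Type u) (_ : AddCommGroup N) (_ : Module R N) (η : ExtM R N R c),
      IsTorsionDualizing J η ∧
      ((∀ (Q : Type u) [AddCommGroup Q] [Module R Q], Module.Injective R Q →
        IsTorsionFreeFor J Q → ∀ j, Subsingleton (ExtM R Q R j)) →
          Function.Bijective (fun r : R ↦ r • η)) :=
  exists_isTorsionDualizing c fun k hk ↦ by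
    rw [← pow_one J]
    exact subsingleton_ext_of_lt_height hJ hk 1

theorem exists_restriction_hom (h : J ≤ I) (hJ : J.height = c) :
    ∃ φ : Module.End R (H J c) →ₐ[R] Module.End R (H I c),
      IsRestriction h c φ ∧ IsInducedByExt h c φ ∧
      (∀ ψ : Module.End R (H J c) →ₐ[R] Module.End R (H I c), IsRestriction h c ψ → ψ = φ) ∧
      ((∀ p ∈ PrimeSpectrum.zeroLocus (J : Set R),
          ringKrullDim (Localization.AtPrime p.asIdeal) ≤ c + 1 → SameRadicalAt J I p) →
        Function.Bijective φ) := by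
  obtain ⟨N, _, _, η, hη, -⟩ := exists_isTorsionDualizing_of_height hJ
  obtain ⟨φ, hφ⟩ := hη.exists_isRestriction h
  refine ⟨φ, hφ, hη.isInducedByExt h hφ, fun ψ hψ ↦ hη.isRestriction_unique h hφ hψ, fun hrad ↦ ?_⟩
  exact hη.restriction_bijective (k := c + 2) h (by lia)
    (mkQ_mem_codimTorsion hrad hη.isPowerTorsion_H (hη.powerTorsion_le_range_incl h)) hφ

end RestrictionHom

/-! ### `Ext` and countable powers -/

section Power

variable {R : Type u} [CommRing R]

/-- The connecting map in the second variable is natural in the short exact sequence. -/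
lemma IsShortExact.post_δ'_naturality {A B C A' B' C' Y : Type u} [AddCommGroup A] [AddCommGroup B]
    [AddCommGroup C] [AddCommGroup A'] [AddCommGroup B'] [AddCommGroup C'] [AddCommGroup Y]
    [Module R A] [Module R B] [Module R C] [Module R A'] [Module R B'] [Module R C'] [Module R Y]
    {f : A →ₗ[R] B} {g : B →ₗ[R] C} {f' : A' →ₗ[R] B'} {g' : B' →ₗ[R] C'}
    (S : IsShortExact f g) (S' : IsShortExact f' g') (α : A →ₗ[R] A') (β : B →ₗ[R] B')
    (γ : C →ₗ[R] C') (h₁ : β ∘ₗ f = f' ∘ₗ α) (h₂ : γ ∘ₗ g = g' ∘ₗ β) {i : ℕ}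
    (e : ExtM R Y C i) : post α Y (i + 1) (S.δ' Y i e) = S'.δ' Y i (post γ Y i e) := by
  let φ : ModuleCat.shortComplexOfCompEqZero f g S.exact.linearMap_comp_eq_zero ⟶
      ModuleCat.shortComplexOfCompEqZero f' g' S'.exact.linearMap_comp_eq_zero :=
    { τ₁ := ModuleCat.ofHom α
      τ₂ := ModuleCat.ofHom β
      τ₃ := ModuleCat.ofHom γ
      comm₁₂ := (congrArg ModuleCat.ofHom h₁).symm
      comm₂₃ := (congrArg ModuleCat.ofHom h₂).symm }
  have hn := ShortComplex.ShortExact.extClass_naturality S.shortExact S'.shortExact φ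
  refine (Abelian.Ext.comp_assoc _ _ _ rfl (add_zero 1) (by lia)).trans ?_
  refine (congrArg (fun z ↦ e.comp z rfl) hn).trans ?_
  exact (Abelian.Ext.comp_assoc _ _ _ (add_zero i) (zero_add 1) (by lia)).symm

section Post

variable {A B C Y : Type u} [AddCommGroup A] [AddCommGroup B] [AddCommGroup C] [AddCommGroup Y]
  [Module R A] [Module R B] [Module R C] [Module R Y]

lemma post_comp (f : A →ₗ[R] B) (g : B →ₗ[R] C) (i : ℕ) (e : ExtM R Y A i) :
    post (g ∘ₗ f) Y i e = post g Y i (post f Y i e) := by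
  simp only [post_apply, ModuleCat.ofHom_comp, Abelian.Ext.comp_assoc_of_third_deg_zero,
    Abelian.Ext.mk₀_comp_mk₀]

lemma post_id (i : ℕ) (e : ExtM R Y A i) : post LinearMap.id Y i e = e := by
  simp only [post_apply, ModuleCat.ofHom_id, Abelian.Ext.comp_mk₀_id]

lemma post_smul (f : A →ₗ[R] B) (r : R) (i : ℕ) (e : ExtM R Y A i) :
    post (r • f) Y i e = r • post f Y i e := by
  have : ModuleCat.ofHom (r • f) = r • ModuleCat.ofHom f := rfl
  simp only [post_apply, this, Abelian.Ext.mk₀_smul, Abelian.Ext.comp_smul]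

lemma post_add (f g : A →ₗ[R] B) (i : ℕ) (e : ExtM R Y A i) :
    post (f + g) Y i e = post f Y i e + post g Y i e := by
  have : ModuleCat.ofHom (f + g) = ModuleCat.ofHom f + ModuleCat.ofHom g := rfl
  simp only [post_apply, this, Abelian.Ext.mk₀_add, Abelian.Ext.comp_add]

end Post

/-- `Ext^i(A, -)` commutes with countable powers. -/
lemma ext_power_bijective {A : Type u} [AddCommGroup A] [Module R A] (i : ℕ) (M : Type u)
    [AddCommGroup M] [Module R M] :
    Function.Bijective fun (e : ExtM R A (ℕ → M) i) (t : ℕ) ↦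
      post (LinearMap.proj t : (ℕ → M) →ₗ[R] M) A i e := by
  induction i generalizing M with
  | zero =>
    constructor
    · intro e e' h
      obtain ⟨f, rfl⟩ := (homEquiv _ _).surjective e
      obtain ⟨f', rfl⟩ := (homEquiv _ _).surjective e'
      refine congrArg _ (LinearMap.ext fun x ↦ funext fun t ↦ ?_)
      have := congrFun h t
      simp only [post_homEquiv] at this
      exact LinearMap.congr_fun ((homEquiv _ _).injective this) x
    · intro e
      refine ⟨homEquiv _ _ (LinearMap.pi fun t ↦ (homEquiv _ _).symm (e t)), funext fun t ↦ ?_⟩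
      simp only [post_homEquiv, LinearMap.proj_pi, LinearEquiv.apply_symm_apply]
  | succ i ih =>
    obtain ⟨E, _, _, j, hE, hj⟩ := exists_injective_embedding (R := R) M
    have S := IsShortExact.of_range_mkQ hj
    set π := (LinearMap.range j).mkQ with hπ
    have S' : IsShortExact (j.compLeft ℕ) (π.compLeft ℕ) :=
      ⟨fun a b h ↦ funext fun t ↦ hj (congrFun h t), fun b ↦ by
        constructor
        · intro h
          choose a ha using fun t ↦ (S.exact (b t)).1 (congrFun h t)
          exact ⟨a, funext ha⟩
        · rintro ⟨a, rfl⟩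
          exact funext fun t ↦ (S.exact _).2 ⟨a t, rfl⟩, fun b ↦ by
        choose a ha using fun t ↦ S.surjective (b t)
        exact ⟨a, funext ha⟩⟩
    have nat : ∀ (t : ℕ) (e : ExtM R A (ℕ → E ⧸ LinearMap.range j) i),
        post (LinearMap.proj t : (ℕ → M) →ₗ[R] M) A (i + 1) (S'.δ' A i e) =
          S.δ' A i (post (LinearMap.proj t : (ℕ → E ⧸ LinearMap.range j) →ₗ[R] _) A i e) :=
      fun t e ↦ S'.post_δ'_naturality S _ (LinearMap.proj t) _ rfl rfl e
    have vanish : ∀ e : ExtM R A E (i + 1), e = 0 := fun e ↦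
      (subsingleton_ext_of_injective (M := A) (N := E) i).elim _ _
    have vanish' : ∀ e : ExtM R A (ℕ → E) (i + 1), e = 0 := fun e ↦
      (subsingleton_ext_of_injective (M := A) (N := ℕ → E) i).elim _ _
    constructor
    · suffices h : ∀ e : ExtM R A (ℕ → M) (i + 1),
          (∀ t, post (LinearMap.proj t : (ℕ → M) →ₗ[R] M) A (i + 1) e = 0) → e = 0 by
        intro e e' hee
        refine sub_eq_zero.1 (h _ fun t ↦ ?_)
        rw [map_sub, sub_eq_zero]
        exact congrFun hee t
      intro e he
      obtain ⟨e, rfl⟩ := S'.exists_δ'_of_post_eq_zero e (vanish' _)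
      choose y hy using fun t ↦ S.exists_post_of_δ'_eq_zero _ ((nat t e).symm.trans (he t))
      obtain ⟨Y, hY⟩ := (ih E).2 y
      have : e = post (π.compLeft ℕ) A i Y := by
        refine (ih _).1 (funext fun t ↦ ?_)
        refine (hy t).symm.trans ?_
        rw [← congrFun hY t]
        simp only [post_apply, Abelian.Ext.comp_assoc_of_third_deg_zero, Abelian.Ext.mk₀_comp_mk₀]
        rfl
      rw [this, S'.δ'_post]
    · intro y
      choose z hz using fun t ↦ S.exists_δ'_of_post_eq_zero (y t) (vanish _)
      obtain ⟨Z, hZ⟩ := (ih _).2 z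
      refine ⟨S'.δ' A i Z, funext fun t ↦ ?_⟩
      refine (nat t Z).trans ?_
      rw [← hz t, ← hZ]

end Power

/-! ### Orthogonality to complete rings -/

section Complete

variable {R : Type u} [CommRing R]

/-- The endomorphism `(a_t) ↦ (a_t - x a_{t+1})` of `R^ℕ`; its kernel and cokernel are `Hom` and
`Ext^1` from `R_x` to `R`. -/
def telescope (x : R) : (ℕ → R) →ₗ[R] (ℕ → R) :=
  LinearMap.id - x • LinearMap.funLeft R R (· + 1)

lemma telescope_apply (x : R) (a : ℕ → R) (t : ℕ) : telescope x a t = a t - x * a (t + 1) := rfl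

lemma telescope_bijective {m : Ideal R} [IsAdicComplete m R] {x : R} (hx : x ∈ m) :
    Function.Bijective (telescope x) := by
  have hxn : ∀ (n : ℕ) (a : R), x ^ n * a ∈ (m ^ n • ⊤ : Ideal R) := fun n a ↦ by
    rw [smul_eq_mul, Ideal.mul_top]
    exact Ideal.mul_mem_right _ _ (Ideal.pow_mem_pow hx n)
  constructor
  · rw [injective_iff_map_eq_zero]
    intro a ha
    have h1 : ∀ t, a t = x * a (t + 1) := fun t ↦ sub_eq_zero.1 (congrFun ha t)
    have h2 : ∀ n t, a t = x ^ n * a (t + n) := by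
      intro n
      induction n with
      | zero => simp
      | succ n ih =>
        intro t
        rw [ih t, h1 (t + n), pow_succ]
        ring_nf
    refine funext fun t ↦
      IsHausdorff.haus (I := m) (M := R) IsAdicComplete.toIsHausdorff _ fun n ↦ ?_
    rw [SModEq.zero, h2 n t]
    exact hxn _ _
  · intro b
    let S (t n : ℕ) : R := ∑ k ∈ Finset.range n, x ^ k * b (t + k)
    have hS : ∀ t n, S t (n + 1) = b t + x * S (t + 1) n := fun t n ↦ by
      simp only [S, Finset.sum_range_succ', Finset.mul_sum, pow_zero, one_mul, add_zero]
      rw [add_comm]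
      congr 1
      refine Finset.sum_congr rfl fun k _ ↦ ?_
      rw [pow_succ, show t + 1 + k = t + (k + 1) by lia]
      ring
    have hC : ∀ t, ∃ L, ∀ n, S t n ≡ L [SMOD (m ^ n • ⊤ : Ideal R)] := fun t ↦
      IsPrecomplete.prec inferInstance fun {p q} hpq ↦ by
        rw [SModEq.comm, SModEq.sub_mem, ← Finset.sum_Ico_eq_sub _ hpq]
        refine Ideal.sum_mem _ fun k hk ↦ ?_
        rw [← Nat.add_sub_of_le (Finset.mem_Ico.1 hk).1, pow_add, mul_assoc]
        exact hxn _ _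
    -- `a_t` is the sum of the series `∑ x^k b_{t+k}`
    choose a ha using hC
    refine ⟨a, funext fun t ↦ ?_⟩
    rw [telescope_apply, ← sub_eq_zero]
    refine IsHausdorff.haus (I := m) (M := R) IsAdicComplete.toIsHausdorff _ fun n ↦ ?_
    rw [SModEq.zero]
    have h1 := SModEq.sub_mem.1 (ha t (n + 1))
    have h2 := SModEq.sub_mem.1 (ha (t + 1) n)
    rw [hS] at h1
    have h3 : b t + x * S (t + 1) n - a t ∈ (m ^ n • ⊤ : Ideal R) :=
      Submodule.smul_mono_left (Ideal.pow_le_pow_right (Nat.le_succ n)) h1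
    rw [show a t - x * a (t + 1) - b t = x * (S (t + 1) n - a (t + 1)) -
      (b t + x * S (t + 1) n - a t) by ring]
    exact sub_mem (Ideal.mul_mem_left _ x h2) h3

/-- If `x` lies in an ideal with respect to which `R` is complete, modules on which `x` acts
bijectively are orthogonal to `R`. -/
lemma subsingleton_ext_of_bijective_smul {m : Ideal R} [IsAdicComplete m R] {x : R} (hx : x ∈ m)
    {A : Type u} [AddCommGroup A] [Module R A] (hA : Function.Bijective (LinearMap.lsmul R A x))
    (i : ℕ) : Subsingleton (ExtM R A R i) := by
  have hb : Function.Bijective fun e : ExtM R A R i ↦ x • e := by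
    have := pre_bijective_of_equiv (Y := R) (LinearEquiv.ofBijective _ hA) i
    convert this using 2 with e
    exact (pre_lsmul x i e).symm
  refine subsingleton_of_forall_eq 0 fun e ↦ ?_
  choose d hd using hb.2
  obtain ⟨y, hy⟩ := (ext_power_bijective i R).2 fun t ↦ d^[t] e
  -- `y` has components `x^{-t} e`, so that the telescope map kills it
  have h0 : post (telescope x) A i y = 0 := by
    refine (ext_power_bijective i R).1 (funext fun t ↦ ?_)
    have h1 : (LinearMap.proj t : (ℕ → R) →ₗ[R] R) =
        LinearMap.proj t ∘ₗ telescope x + x • LinearMap.proj (t + 1) :=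
      LinearMap.ext fun a ↦ (sub_add_cancel (a t) (x * a (t + 1))).symm
    have h2 : post (LinearMap.proj t) A i y = post (LinearMap.proj t ∘ₗ telescope x) A i y +
        x • post (LinearMap.proj (t + 1)) A i y := by
      conv_lhs => rw [h1]
      rw [post_add, post_smul]
    have h3 : ∀ t, post (LinearMap.proj t) A i y = d^[t] e := congrFun hy
    rw [h3, h3, Function.iterate_succ_apply'] at h2
    have h4 := h2.trans (congrArg (_ + ·) (hd _))
    exact (post_comp _ _ _ _).symm.trans ((right_eq_add.1 h4).trans (map_zero _).symm)
  have hy0 : y = 0 := by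
    have h1 : (LinearEquiv.ofBijective _ (telescope_bijective hx)).symm.toLinearMap ∘ₗ
        telescope x = LinearMap.id :=
      LinearMap.ext (LinearEquiv.ofBijective _ (telescope_bijective hx)).symm_apply_apply
    rw [← post_id i y, ← h1, post_comp, h0, map_zero]
  have := congrFun hy 0
  rw [hy0] at this
  exact this.symm.trans (map_zero _)

end Complete

/-! ### Torsion-free injective modules over complete rings -/

section Orthogonal

variable {R : Type u} [CommRing R] [IsNoetherianRing R]

/-- A torsion-free injective module over a complete ring is orthogonal to the ring. For a principal
ideal this holds as the generator acts bijectively; the general case follows by dévissage along a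
list of generators. -/
lemma subsingleton_ext_of_injective_torsionFree {m : Ideal R} [IsAdicComplete m R] (J : Ideal R)
    (hJm : J ≤ m) (Q : Type u) [AddCommGroup Q] [Module R Q] (hQ : Module.Injective R Q)
    (hQJ : IsTorsionFreeFor J Q) (i : ℕ) : Subsingleton (ExtM R Q R i) := by
  have hfg : J.FG := IsNoetherian.noetherian J
  induction J, hfg using Submodule.fg_induction generalizing Q with
  | singleton x =>
    have hx : x ∈ m := hJm (Submodule.mem_span_singleton_self x)
    have hinj : Function.Injective (LinearMap.lsmul R Q x) := by
      rw [injective_iff_map_eq_zero]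
      refine fun q hq ↦ hQJ q fun a ha ↦ ?_
      obtain ⟨r, rfl⟩ := Submodule.mem_span_singleton.1 ha
      rw [smul_assoc]
      exact (congrArg (r • ·) hq).trans (smul_zero r)
    refine subsingleton_ext_of_bijective_smul hx ⟨hinj, fun q ↦ ?_⟩ i
    obtain ⟨h, hh⟩ := hQ.out _ hinj LinearMap.id
    exact ⟨h q, (map_smul h x q).symm.trans (hh q)⟩
  | sup J₁ J₂ _ _ ih₁ ih₂ =>
    have h₂ : IsTorsionFreeFor J₂ (powerTorsion J₁ Q) := fun q hq ↦ by
      obtain ⟨t, ht⟩ := q.2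
      refine Subtype.ext (hQJ.eq_zero ⟨t + 1, fun a ha ↦ ?_⟩)
      have h3 : (J₁ ⊔ J₂) ^ (t + 1) ≤ J₁ ^ t ⊔ J₂ := by
        have := Ideal.sup_pow_add_le_pow_sup_pow (I := J₁) (J := J₂) (n := t) (m := 1)
        rwa [pow_one] at this
      obtain ⟨b, hb, d, hd, rfl⟩ := Submodule.mem_sup.1 (h3 ha)
      rw [add_smul, ht b hb, zero_add]
      exact congrArg Subtype.val (hq d hd)
    exact (IsShortExact.of_mkQ (powerTorsion J₁ Q)).subsingleton_mid
      (ih₂ (le_sup_right.trans hJm) _ injective_powerTorsion h₂)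
      (ih₁ (le_sup_left.trans hJm) _ injective_quotient_powerTorsion
        (isTorsionFreeFor_quotient_powerTorsion J₁ Q))

end Orthogonal

/-! ### Vanishing of local cohomology of modules -/

section LimExt

variable {R : Type u} [CommRing R] {J : Ideal R} {M N : Type u} [AddCommGroup M] [Module R M]
  [AddCommGroup N] [Module R N]

/-- The direct limit over `t` of the modules `Ext^i(R/J^t, M)` vanishes. -/
def LimExtVanishes (J : Ideal R) (i : ℕ) (M : Type u) [AddCommGroup M] [Module R M] : Prop :=
  ∀ (t : ℕ) (e : ExtM R (R ⧸ J ^ t) M i), ∃ s, ∃ h : t ≤ s,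
    pre (quotMap (Ideal.pow_le_pow_right (I := J) h)).hom M i e = 0

lemma pre_quotMap_trans {t s r : ℕ} (h : t ≤ s) (h' : s ≤ r) {i : ℕ}
    (e : ExtM R (R ⧸ J ^ t) M i) :
    pre (quotMap (Ideal.pow_le_pow_right (I := J) (h.trans h'))).hom M i e =
      pre (quotMap (Ideal.pow_le_pow_right (I := J) h')).hom M i
        (pre (quotMap (Ideal.pow_le_pow_right (I := J) h)).hom M i e) := by
  rw [← quotMap_comp (Ideal.pow_le_pow_right h') (Ideal.pow_le_pow_right h), ModuleCat.hom_comp,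
    pre_comp]

lemma LimExtVanishes.isTorsionFreeFor (h : LimExtVanishes J 0 M) : IsTorsionFreeFor J M := by
  intro x hx
  have hx' : ∀ a ∈ J ^ 1, a • x = 0 := fun a ha ↦ hx a (by simpa using ha)
  obtain ⟨s, hs, h0⟩ := h 1 (homEquiv _ _ (levelHom J 1 x hx'))
  rw [pre_homEquiv] at h0
  have := LinearMap.congr_fun ((homEquiv _ _).map_eq_zero_iff.1 h0) (Submodule.Quotient.mk 1)
  exact (one_smul R x).symm.trans this

lemma limExtVanishes_zero (h : IsTorsionFreeFor J M) : LimExtVanishes J 0 M := by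
  intro t e
  refine ⟨t, le_rfl, ?_⟩
  obtain ⟨f, rfl⟩ := (homEquiv _ _).surjective e
  rw [h.linearMap_eq_zero (isPowerTorsion_quotient_pow t) f, map_zero, map_zero]

/-- A module of power torsion embeds into an injective module of power torsion. -/
lemma IsPowerTorsion.exists_injective_embedding [IsNoetherianRing R] (hM : IsPowerTorsion J M) :
    ∃ (E : Type u) (_ : AddCommGroup E) (_ : Module R E) (f : M →ₗ[R] E),
      Module.Injective R E ∧ IsPowerTorsion J E ∧ Function.Injective f := by
  obtain ⟨E, _, _, j, hE, hj⟩ := LocalCohomologyEnd.exists_injective_embedding (R := R) M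
  exact ⟨powerTorsion J E, inferInstance, inferInstance,
    LinearMap.codRestrict _ j fun m ↦ map_mem_powerTorsion j (hM m), injective_powerTorsion,
    isPowerTorsion_powerTorsion, fun a b h ↦ hj (congrArg Subtype.val h)⟩

/-- Modules of `J`-power torsion have no higher local cohomology. -/
lemma IsPowerTorsion.limExtVanishes [IsNoetherianRing R] (hM : IsPowerTorsion J M) (i : ℕ) :
    LimExtVanishes J (i + 1) M := by
  induction i generalizing M with
  | zero =>
    intro t e
    obtain ⟨E, _, _, k, hE, hE't, hk⟩ := hM.exists_injective_embedding
    have S := IsShortExact.of_range_mkQ hk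
    obtain ⟨e, rfl⟩ := S.exists_δ'_of_post_eq_zero e ((subsingleton_ext_of_injective 0).elim _ _)
    obtain ⟨g, rfl⟩ := (homEquiv _ _).surjective e
    obtain ⟨y, hy⟩ := S.surjective (g (Submodule.Quotient.mk 1))
    obtain ⟨s, hs⟩ := hE't y
    have hs' : ∀ a ∈ J ^ (t + s), a • y = 0 := fun a ha ↦
      hs a (Ideal.pow_le_pow_right (Nat.le_add_left _ _) ha)
    refine ⟨t + s, Nat.le_add_right _ _, ?_⟩
    rw [S.pre_δ', pre_homEquiv]
    have : g ∘ₗ (quotMap (Ideal.pow_le_pow_right (I := J) (Nat.le_add_right t s))).hom =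
        (LinearMap.range k).mkQ ∘ₗ levelHom J (t + s) y hs' := by
      apply LinearMap.ext
      intro z
      obtain ⟨z, rfl⟩ := Submodule.mkQ_surjective _ z
      have h1 : (quotMap (Ideal.pow_le_pow_right (I := J) (Nat.le_add_right t s))).hom
        ((J ^ (t + s)).mkQ z) = z • Submodule.Quotient.mk 1 := by
        rw [← Submodule.Quotient.mk_smul, smul_eq_mul, mul_one]
        rfl
      rw [LinearMap.comp_apply, h1, map_smul, ← hy, ← map_smul]
      rfl
    rw [this, ← post_homEquiv, S.δ'_post]
  | succ i ih =>
    intro t e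
    obtain ⟨E, _, _, k, hE, hEt, hk⟩ := hM.exists_injective_embedding
    have S := IsShortExact.of_range_mkQ hk
    obtain ⟨e, rfl⟩ := S.exists_δ'_of_post_eq_zero e
      ((subsingleton_ext_of_injective (i + 1)).elim _ _)
    obtain ⟨s, h, hs⟩ := ih (hEt.of_surjective (Submodule.mkQ_surjective (LinearMap.range k))) t e
    exact ⟨s, h, by rw [S.pre_δ', hs, map_zero]⟩

/-- The quotient of a module without higher local cohomology by its power torsion has no local
cohomology. -/
lemma limExtVanishes_quotient [IsNoetherianRing R] (h : ∀ i, LimExtVanishes J (i + 1) M) (i : ℕ) :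
    LimExtVanishes J i (M ⧸ powerTorsion J M) := by
  cases i with
  | zero => exact limExtVanishes_zero (isTorsionFreeFor_quotient_powerTorsion J M)
  | succ i =>
    intro t e
    have S := IsShortExact.of_mkQ (powerTorsion J M)
    obtain ⟨s, hts, hs⟩ := isPowerTorsion_powerTorsion.limExtVanishes (i + 1) t (S.δ' _ _ e)
    rw [S.pre_δ'] at hs
    obtain ⟨e', he'⟩ := S.exists_post_of_δ'_eq_zero _ hs
    obtain ⟨r, hsr, hr⟩ := h i s e'
    refine ⟨r, hts.trans hsr, ?_⟩
    rw [pre_quotMap_trans hts hsr, ← he', pre_post, hr, map_zero]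

/-- Over a ring of finite injective dimension to which torsion-free injectives are orthogonal, all
modules without local cohomology are orthogonal to the ring. -/
lemma subsingleton_ext_of_limExtVanishes [IsNoetherianRing R]
    (hd : ∃ d : ℕ, ∀ (M : Type u) [AddCommGroup M] [Module R M] (i : ℕ), d ≤ i →
      Subsingleton (ExtM R M R i))
    (hQ : ∀ (Q : Type u) [AddCommGroup Q] [Module R Q], Module.Injective R Q →
        IsTorsionFreeFor J Q → ∀ j, Subsingleton (ExtM R Q R j))
    (h : ∀ i, LimExtVanishes J i M) (j : ℕ) : Subsingleton (ExtM R M R j) := by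
  obtain ⟨d, hd⟩ := hd
  suffices key : ∀ (n : ℕ) (M : Type u) [AddCommGroup M] [Module R M],
      (∀ i, LimExtVanishes J i M) → ∀ j, d ≤ j + n → Subsingleton (ExtM R M R j) from
    key d M h j (Nat.le_add_left _ _)
  intro n
  induction n with
  | zero => exact fun M _ _ _ j hj ↦ hd M j hj
  | succ n ih =>
    intro M _ _ h j hj
    obtain ⟨Q, _, _, f, hQi, hQJ, hf⟩ :=
      exists_torsionFree_injective_embedding (h 0).isTorsionFreeFor
    have S := IsShortExact.of_range_mkQ hf
    refine S.subsingleton_left (hQ Q hQi hQJ j) (ih _ (fun i t e ↦ ?_) (j + 1) (by lia))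
    obtain ⟨s, hts, hs⟩ := h (i + 1) t (S.δ' _ _ e)
    refine ⟨s, hts, ?_⟩
    rw [S.pre_δ'] at hs
    obtain ⟨e', he'⟩ := S.exists_post_of_δ'_eq_zero _ hs
    rw [← he', (subsingleton_ext_of_isPowerTorsion hQJ (isPowerTorsion_quotient_pow s) i).elim e' 0,
      map_zero]

/-- Passing from `R` to the last cosyzygy `N` shifts local cohomology by `c`. -/
lemma IsTorsionDualizing.limExtVanishes {c : ℕ} {η : ExtM R N R c} (hη : IsTorsionDualizing J η)
    {i : ℕ} (h : LimExtVanishes J (i + c) R) : LimExtVanishes J i N := by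
  intro t e
  obtain ⟨s, hts, hs⟩ := h t (e.comp η rfl)
  refine ⟨s, hts, (hη _ (isPowerTorsion_quotient_pow s) i _ rfl).1 ?_⟩
  refine Eq.trans ?_ (hs.trans (Eq.symm (Abelian.Ext.zero_comp ..)))
  exact Abelian.Ext.comp_assoc _ _ _ (zero_add i) rfl (by lia)

end LimExt

/-! ### Endomorphisms for cohomologically complete intersections -/

section CohomologicallyComplete

variable {R : Type u} [CommRing R] {J : Ideal R} {c : ℕ}

lemma limExtVanishes_of_subsingleton {i : ℕ} (h : Subsingleton (H J i)) :
    LimExtVanishes J i R :=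
  fun t e ↦ ofLevel_eq_zero J i t e (h.elim _ _)

lemma IsCohomologicallyCompleteIntersection.subsingleton (hJ : J.height = c)
    (h : IsCohomologicallyCompleteIntersection J) {i : ℕ} (hi : c < i) :
    Subsingleton (H J i) := by
  by_contra hne
  rw [not_subsingleton_iff_nontrivial] at hne
  have h1 : (i : ℕ∞) ≤ J.height := h.symm ▸ le_iSup₂ (f := fun (i : ℕ) (_ : Nontrivial (H J i)) ↦
    (i : ℕ∞)) i hne
  rw [hJ, Nat.cast_le] at h1
  lia

/-- For a cohomologically complete intersection `J` in a complete ring, the endomorphisms of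
`H^c_J(R)` are the homotheties. -/
theorem algebraMap_end_bijective [IsLocalGorenstein R]
    [IsAdicComplete (IsLocalRing.maximalIdeal R) R] (hJ : J.height = c)
    (hcci : IsCohomologicallyCompleteIntersection J) :
    Function.Bijective (algebraMap R (Module.End R (H J c))) := by
  obtain ⟨N, _, _, η, hη, hB⟩ := exists_isTorsionDualizing_of_height hJ
  have hJm : J ≤ IsLocalRing.maximalIdeal R := IsLocalRing.le_maximalIdeal (by
    rintro rfl
    simp at hJ)
  have hQ : ∀ (Q : Type u) [AddCommGroup Q] [Module R Q], Module.Injective R Q →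
      IsTorsionFreeFor J Q → ∀ j, Subsingleton (ExtM R Q R j) := fun Q _ _ hQ hQJ j ↦
    subsingleton_ext_of_injective_torsionFree J hJm Q hQ hQJ j
  have hN : ∀ i, LimExtVanishes J (i + 1) N := fun i ↦
    hη.limExtVanishes (limExtVanishes_of_subsingleton (hcci.subsingleton hJ (by lia)))
  have hV : ∀ j, Subsingleton (ExtM R (N ⧸ LinearMap.range hη.ofH) R j) := by
    have hr : LinearMap.range hη.ofH = powerTorsion J N := le_antisymm
      (by rintro _ ⟨x, rfl⟩; exact hη.ofH_mem x) fun x hx ↦ hη.exists_ofH_eq hx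
    rw [hr]
    exact subsingleton_ext_of_limExtVanishes (exists_forall_subsingleton_ext R) hQ
      (limExtVanishes_quotient hN)
  have S := IsShortExact.of_range_mkQ hη.ofH_injective
  have hpre : Function.Bijective (pre hη.ofH R c) := by
    refine ⟨(injective_iff_map_eq_zero _).2 fun e he ↦ ?_, fun e ↦
      S.exists_pre_of_δ_eq_zero e ((hV _).elim _ _)⟩
    obtain ⟨e, rfl⟩ := S.exists_pre_of_pre_eq_zero e he
    rw [(hV c).elim e 0, map_zero]
  refine (Function.Bijective.of_comp_iff' hη.endToExt_bijective _).1 ?_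
  convert hpre.comp (hB hQ) using 1
  funext r
  have h1 : algebraMap R (Module.End R (H J c)) r = r • LinearMap.id := rfl
  rw [Function.comp_apply, Function.comp_apply, h1, map_smul, map_smul, hη.endToExt_apply, pre_id]

end CohomologicallyComplete

/-! ### Splitting off the saturation -/

section Saturation

variable {R : Type u} [CommRing R] [IsNoetherianRing R] {J I : Ideal R}

variable (J I) in
/-- The saturation `L = (J : I^∞)`, together with an exponent at which it is reached. -/
lemma exists_saturation : ∃ (L : Ideal R) (n : ℕ), L * I ^ n ≤ J ∧
    ∀ (s : R) (t : ℕ), Ideal.span {s} * I ^ t ≤ J → s ∈ L := by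
  obtain ⟨n, hn⟩ := exists_pow_forall_smul_eq_zero (J := I) (powerTorsion I (R ⧸ J)).subtype
    fun m ↦ m.2
  refine ⟨(powerTorsion I (R ⧸ J)).comap J.mkQ, n, Ideal.mul_le.2 fun r hr a ha ↦ ?_,
    fun s t hst ↦ ⟨t, fun a ha ↦ ?_⟩⟩
  · have := hn a ha ⟨_, hr⟩
    rw [mul_comm]
    exact (Submodule.Quotient.mk_eq_zero J).1 this
  · refine (Submodule.Quotient.mk_eq_zero J).2 ?_
    change a * s ∈ J
    rw [mul_comm]
    exact hst (Ideal.mul_mem_mul (Ideal.mem_span_singleton_self s) ha)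

variable {c n : ℕ} {L : Ideal R} {M : Type u} [AddCommGroup M] [Module R M]

/-- If `J` and `I` agree up to radical at primes of `V(I)` of height at most `c + 1`, then
`M / (Γ_I(M) + Γ_L(M))` is supported in codimension at least `c + 2`. -/
lemma mkQ_mem_codimTorsion_of_saturation (hL : L * I ^ n ≤ J)
    (h : ∀ p ∈ PrimeSpectrum.zeroLocus (I : Set R),
      ringKrullDim (Localization.AtPrime p.asIdeal) ≤ c + 1 → SameRadicalAt J I p)
    (hM : IsPowerTorsion J M) {P : Submodule R M} (hP : powerTorsion I M ≤ P)
    (hP' : powerTorsion L M ≤ P) (x : M) : P.mkQ x ∈ codimTorsion J (c + 2) (M ⧸ P) := by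
  refine ⟨map_mem_powerTorsion _ (hM x), fun p hp hle ↦ ?_⟩
  by_contra! hlt
  obtain ⟨k, hk⟩ := hM x
  by_cases hIp : I ≤ p
  · obtain ⟨s, hs, t, hst⟩ := exists_span_mul_pow_le_of_height_lt hp hlt (h ⟨p, hp⟩ hIp)
    refine hs (hp.mem_of_pow_mem k (hle _ ?_))
    rw [← map_smul, Submodule.mkQ_apply, Submodule.Quotient.mk_eq_zero]
    exact hP (powerTorsion_pow_le t (pow_smul_mem_powerTorsion hk hst
      (Ideal.pow_mem_pow (Ideal.mem_span_singleton_self s) k)))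
  · obtain ⟨b, hb, hbp⟩ := SetLike.not_le_iff_exists.1 hIp
    refine hbp (hp.mem_of_pow_mem n (hp.mem_of_pow_mem k (hle _ ?_)))
    rw [← map_smul, Submodule.mkQ_apply, Submodule.Quotient.mk_eq_zero]
    exact hP' (pow_smul_mem_powerTorsion hk (mul_comm L _ ▸ hL)
      (Ideal.pow_mem_pow (Ideal.pow_mem_pow hb n) k))

/-- If `J` and `I` agree up to radical at primes of `V(I)` of height at most `c + 1`, then no such
prime contains the saturation. -/
lemma mem_codimTorsion_of_saturation (hL : ∀ (s : R) (t : ℕ), Ideal.span {s} * I ^ t ≤ J → s ∈ L)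
    (h : ∀ p ∈ PrimeSpectrum.zeroLocus (I : Set R),
      ringKrullDim (Localization.AtPrime p.asIdeal) ≤ c + 1 → SameRadicalAt J I p)
    (hM : IsPowerTorsion J M) {x : M} (hI : x ∈ powerTorsion I M) (hxL : x ∈ powerTorsion L M) :
    x ∈ codimTorsion J (c + 2) M := by
  refine ⟨hM x, fun p hp hle ↦ ?_⟩
  by_contra! hlt
  obtain ⟨k, hk⟩ := hI
  obtain ⟨l, hl⟩ := hxL
  have hIp : I ≤ p := hp.le_of_pow_le fun a ha ↦ hle a (hk a ha)
  have hLp : L ≤ p := hp.le_of_pow_le fun a ha ↦ hle a (hl a ha)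
  obtain ⟨s, hs, t, hst⟩ := exists_span_mul_pow_le_of_height_lt hp hlt (h ⟨p, hp⟩ hIp)
  exact hs (hLp (hL s t hst))

end Saturation

/-! ### Endomorphisms for larger ideals -/

section Homotheties

variable {R : Type u} [CommRing R] [IsLocalGorenstein R] {J I : Ideal R} {c : ℕ}
  {N : Type u} [AddCommGroup N] [Module R N] {η : ExtM R N R c}

/-- `H^c_I(R)` does not vanish, as it does not vanish at a minimal prime of `I` of height `c`. -/
lemma IsTorsionDualizing.nontrivial_H (hη : IsTorsionDualizing I η) (hI : I.height = c) :
    Nontrivial (H I c) := by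
  obtain ⟨p, hp, hpc⟩ : ∃ p ∈ I.minimalPrimes, p.height = c := by
    by_contra! hne
    have hle : ((c + 1 : ℕ) : ℕ∞) ≤ I.height := by
      rw [Ideal.height_eq_inf_minimalPrimes]
      refine le_iInf₂ fun p hp ↦ ?_
      push_cast
      refine Order.add_one_le_of_lt (lt_of_le_of_ne ?_ (hne p hp).symm)
      exact hI ▸ Ideal.height_mono hp.1.2
    rw [hI, Nat.cast_le] at hle
    lia
  have := hp.1.1
  by_contra hne
  rw [not_nontrivial_iff_subsingleton] at hne
  have ht : IsPowerTorsion I (R ⧸ p) := (isPowerTorsion_quotient (J := p)).mono hp.1.2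
  refine not_subsingleton_iff_nontrivial.2 (extLocNonzero_of_height hpc).nontrivial ?_
  refine subsingleton_of_forall_eq 0 fun e ↦ ?_
  obtain ⟨f, rfl⟩ := (hη.pre_bijective ht).2 e
  obtain ⟨g, rfl⟩ := hη.exists_ofH_comp_eq ht f
  have hg : g = 0 := LinearMap.ext fun x ↦ hne.elim _ _
  change pre _ _ _ _ = 0
  rw [hg, LinearMap.comp_zero, pre_zero]

/-- Up to modules supported in codimension at least `c + 2`, the module `H^c_J(R)` is the direct sum
of its power torsion for `I` and for the saturation `L = (J : I^∞)`. If all endomorphisms of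
`H^c_J(R)` are homotheties, then locality of `R` and `H^c_I(R) ≠ 0` make the `L`-torsion vanish. -/
theorem IsTorsionDualizing.restriction_bijective_of_homotheties (hη : IsTorsionDualizing J η)
    (hJI : J ≤ I) (hI : I.height = c)
    (hend : Function.Surjective (algebraMap R (Module.End R (H J c))))
    (h : ∀ p ∈ PrimeSpectrum.zeroLocus (I : Set R),
      ringKrullDim (Localization.AtPrime p.asIdeal) ≤ c + 1 → SameRadicalAt J I p)
    {φ : Module.End R (H J c) →ₐ[R] Module.End R (H I c)} (hφ : IsRestriction hJI c φ) :
    Function.Bijective φ := by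
  obtain ⟨L, n, hL, hL'⟩ := exists_saturation J I
  have hH := hη.isPowerTorsion_H
  let ι : powerTorsion L (H J c) × powerTorsion I (H J c) →ₗ[R] H J c :=
    (powerTorsion L (H J c)).subtype.coprod (powerTorsion I (H J c)).subtype
  have hι : Function.Injective ι := by
    rw [injective_iff_map_eq_zero]
    rintro ⟨⟨a, ha⟩, ⟨b, hb⟩⟩ hab
    have hab' : a + b = 0 := hab
    have hbL : b ∈ powerTorsion L (H J c) := by
      rw [← neg_eq_of_add_eq_zero_right hab']
      exact neg_mem ha
    have hb0 : b = 0 := hη.ofH_injective <| by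
      rw [map_zero]
      exact hη.eq_zero_of_mem_codimTorsion (k := c + 2) (by lia)
        (map_mem_codimTorsion _ (mem_codimTorsion_of_saturation hL' h hH hb hbL))
    subst hb0
    rw [add_zero] at hab'
    subst hab'
    rfl
  have hext := hη.comp_bijective_of_codim (k := c + 2) (by lia) hι fun y ↦ by
    obtain ⟨x, rfl⟩ := Submodule.mkQ_surjective _ y
    exact mkQ_mem_codimTorsion_of_saturation hL h hH (P := LinearMap.range ι)
      (fun b hb ↦ ⟨(0, ⟨b, hb⟩), zero_add b⟩) (fun a ha ↦ ⟨(⟨a, ha⟩, 0), add_zero a⟩) x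
  -- the projection to the `L`-torsion extends to a homothety of `H^c_J(R)`
  obtain ⟨g, hg⟩ := hext.2 (hη.ofH ∘ₗ (powerTorsion L (H J c)).subtype ∘ₗ LinearMap.fst R _ _)
  obtain ⟨f, rfl⟩ := hη.exists_ofH_comp_eq hH g
  obtain ⟨r, rfl⟩ := hend f
  have hr : ∀ z, r • ι z = (z.1 : H J c) := fun z ↦ hη.ofH_injective (LinearMap.congr_fun hg z)
  have hL0 : ∀ a ∈ powerTorsion L (H J c), a = 0 := fun a ha ↦ by
    have hra : r • a = a := 
      (congrArg (r • ·) (add_zero a)).symm.trans (hr (⟨a, ha⟩, 0))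
    rcases IsLocalRing.isUnit_or_isUnit_one_sub_self r with hu | hu
    · exfalso
      have hI' := hη.mono hJI
      obtain ⟨x, hx⟩ := @exists_ne _ (hI'.nontrivial_H hI) 0
      have hx' := map_mem_powerTorsion (incl hJI c) (hI'.isPowerTorsion_H x)
      have hrx : r • incl hJI c x = 0 := 
        (congrArg (r • ·) (zero_add _)).symm.trans (hr (0, ⟨_, hx'⟩))
      rw [hu.smul_eq_zero] at hrx
      exact hx (hη.incl_injective hJI (hrx.trans (map_zero _).symm))
    · rw [← hu.smul_eq_zero (x := a), sub_smul, one_smul, hra, sub_self]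
  refine hη.restriction_bijective (k := c + 2) hJI (by lia) (mkQ_mem_codimTorsion_of_saturation
    hL h hH (hη.powerTorsion_le_range_incl hJI) fun a ha ↦ ?_) hφ
  rw [hL0 a ha]
  exact zero_mem _

/-- The homothety map `R → End(H^c_I(R))` factors through `End(H^c_J(R))`. -/
theorem algebraMap_end_bijective_of_le (hJI : J ≤ I) (hJ : J.height = c) (hI : I.height = c)
    (hend : Function.Bijective (algebraMap R (Module.End R (H J c))))
    (h : ∀ p ∈ PrimeSpectrum.zeroLocus (I : Set R),
      ringKrullDim (Localization.AtPrime p.asIdeal) ≤ c + 1 → SameRadicalAt J I p) :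
    Function.Bijective (algebraMap R (Module.End R (H I c))) := by
  obtain ⟨N, _, _, η, hη, -⟩ := exists_isTorsionDualizing_of_height hJ
  obtain ⟨φ, hφ⟩ := hη.exists_isRestriction hJI
  rw [← φ.comp_algebraMap, RingHom.coe_comp]
  exact (hη.restriction_bijective_of_homotheties hJI hI hend.2 h hφ).comp hend

end Homotheties

end LocalCohomologyEnd

end

open LocalCohomologyEnd in
theorem theorem1p2 {R : Type u} [CommRing R] [IsLocalGorenstein R]
    (J I : Ideal R) (hJI : J ≤ I) (c : ℕ) (hJ : J.height = c) (hI : I.height = c) :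
    -- (a), (b)
    (∃ φ : Module.End R (H J c) →ₐ[R] Module.End R (H I c),
      IsRestriction hJI c φ ∧ IsInducedByExt hJI c φ ∧
      (∀ ψ : Module.End R (H J c) →ₐ[R] Module.End R (H I c), IsRestriction hJI c ψ → ψ = φ) ∧
      ((∀ p ∈ PrimeSpectrum.zeroLocus (J : Set R),
          ringKrullDim (Localization.AtPrime p.asIdeal) ≤ c + 1 → SameRadicalAt J I p) →
        Function.Bijective φ)) ∧
    -- (c)
    (IsAdicComplete (IsLocalRing.maximalIdeal R) R →
      IsCohomologicallyCompleteIntersection J →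
      (∀ p ∈ PrimeSpectrum.zeroLocus (I : Set R),
          ringKrullDim (Localization.AtPrime p.asIdeal) ≤ c + 1 → SameRadicalAt J I p) →
      Function.Bijective (algebraMap R (Module.End R (H I c)))) := by
  refine ⟨exists_restriction_hom hJI hJ, fun _ hcci h ↦ ?_⟩
  exact algebraMap_end_bijective_of_le hJI hJ hI (algebraMap_end_bijective hJ hcci) h
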